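/- Conventions. For a connected open set $D\subset\mathbb C^n$, $z,x,y,o\in D$ and $X\in\mathbb C^n$ let $$\kappa_D(z;X)=\inf\{|\alpha|:\ \alpha\in\mathbb C,\ \exists\,\varphi:\mathbb D\to D \text{ holomorphic},\ \varphi(0)=z,\ \alpha\varphi'(0)=X\},\qquad k_D(x,y)=\inf_\gamma\int_0^1\kappa_D(\gamma(t);\gamma'(t))\,dt,$$ the infimum being over all piecewise $\mathcal C^1$ curves $\gamma:[0,1]\to D$ from $x$ to $y$, and let $(x|y)_o=\tfrac12\,[k_D(x,o)+k_D(o,y)-k_D(x,y)]$. A geodesic is a curve $\sigma:[0,L]\to D$ with $k_D(\sigma(s),\sigma(t))=|s-t|$ for all $s,t\in[0,L]$. The domain $D$ has the visibility property if for all $p\ne q$ in $\partial D$ there are neighborhoods $U$ of $p$ and $V$ of $q$ with $\overline U\cap\overline V=\emptyset$ and a compact set $K\subset D$ such that every geodesic $\sigma:[0,L]\to D$ with $\sigma(0)\in U$, $\sigma(L)\in V$ meets $K$. Statement. Let $\psi,\chi_1,\chi_2:\mathbb R\to[0,\infty)$ be $\mathcal C^\infty$ even functions, strictly increasing on $[0,\infty)$,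 with $\psi(0)=\chi_1(0)=\chi_2(0)=0$. Let $\Omega_\psi\subset\mathbb C^2$ be a convex domain with $\mathcal C^\infty$ boundary, contained in the ball $B(0,5)$, such that $$\Omega_\psi\cap\{\|z\|<3\}=\{z\in\mathbb C^2:\ \|z\|<3,\ \operatorname{Re} z_2>\psi(\operatorname{Re} z_1)+\chi_1\big((|\operatorname{Im} z_1|-2)_+\big)+\chi_2(\operatorname{Im} z_2)\}.$$ Let $p=(i,0)$ and $q=(-i,0)$. If $\psi(x)=o\big(\exp(-\tfrac{\pi}{2x})\big)$ as $x\to0^+$, then for every base point $o\in\Omega_\psi$ $$\limsup_{\Omega_\psi\times\Omega_\psi\ni(p',q')\to(p,q)}(p'|q')_o=\infty,$$ and $\Omega_\psi$ does not have the visibility property. -/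

import Mathlib

open Set Filter Topology MeasureTheory
open scoped ENNReal ContDiff

noncomputable section

/-- The Kobayashi–Royden pseudometric
`κ_D(z; X) = inf {|α| : ∃ φ ∈ 𝒪(𝔻, D), φ(0) = z, α φ'(0) = X}`. -/
def kobayashiRoyden {n : ℕ} (D : Set (EuclideanSpace ℂ (Fin n)))
    (z X : EuclideanSpace ℂ (Fin n)) : ℝ :=
  sInf {r : ℝ | ∃ (α : ℂ) (φ : ℂ → EuclideanSpace ℂ (Fin n)),
    DifferentiableOn ℂ φ (Metric.ball 0 1) ∧ MapsTo φ (Metric.ball 0 1) D ∧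
    φ 0 = z ∧ α • deriv φ 0 = X ∧ r = ‖α‖}

/-- `γ` restricted to `[0,1]` is a piecewise `C¹` curve in `D` from `x` to `y`: it is continuous
and there is a partition `0 = t₀ ≤ t₁ ≤ ⋯ ≤ t_N = 1` such that `γ` is `C¹` on every closed
interval `[t_i, t_{i+1}]`. -/
def IsPiecewiseC1Curve {n : ℕ} (D : Set (EuclideanSpace ℂ (Fin n)))
    (x y : EuclideanSpace ℂ (Fin n)) (γ : ℝ → EuclideanSpace ℂ (Fin n)) : Prop :=
  ContinuousOn γ (Icc 0 1) ∧ MapsTo γ (Icc 0 1) D ∧ γ 0 = x ∧ γ 1 = y ∧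
    ∃ (N : ℕ) (t : ℕ → ℝ), Monotone t ∧ t 0 = 0 ∧ t N = 1 ∧
      ∀ i < N, ContDiffOn ℝ 1 γ (Icc (t i) (t (i + 1)))

/-- The infimum of the Kobayashi–Royden lengths of the piecewise `C¹` curves in `D` from `x`
to `y`, as an extended nonnegative number (`∞` if there is no such curve). -/
def kobayashiEDist {n : ℕ} (D : Set (EuclideanSpace ℂ (Fin n)))
    (x y : EuclideanSpace ℂ (Fin n)) : ℝ≥0∞ :=
  ⨅ (γ : ℝ → EuclideanSpace ℂ (Fin n)) (_ : IsPiecewiseC1Curve D x y γ),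
    ∫⁻ t in Icc (0 : ℝ) 1, ENNReal.ofReal (kobayashiRoyden D (γ t) (deriv γ t))

/-- The Kobayashi pseudodistance `k_D(x, y)`, for points of a connected open set `D`
(for which the infimum above is finite). -/
def kobayashiDist {n : ℕ} (D : Set (EuclideanSpace ℂ (Fin n)))
    (x y : EuclideanSpace ℂ (Fin n)) : ℝ :=
  (kobayashiEDist D x y).toReal

/-- The Gromov product `(x|y)_o` for the Kobayashi distance of `D`. -/
def gromovProduct {n : ℕ} (D : Set (EuclideanSpace ℂ (Fin n)))
    (o x y : EuclideanSpace ℂ (Fin n)) : ℝ :=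
  (kobayashiDist D x o + kobayashiDist D o y - kobayashiDist D x y) / 2

/-- `σ` restricted to `[0, L]` is a geodesic of `D` for the Kobayashi distance. -/
def IsKobayashiGeodesic {n : ℕ} (D : Set (EuclideanSpace ℂ (Fin n)))
    (L : ℝ) (σ : ℝ → EuclideanSpace ℂ (Fin n)) : Prop :=
  ContinuousOn σ (Icc 0 L) ∧ MapsTo σ (Icc 0 L) D ∧
    ∀ s ∈ Icc (0 : ℝ) L, ∀ t ∈ Icc (0 : ℝ) L, kobayashiDist D (σ s) (σ t) = |s - t|

/-- The pair `{p, q}` of boundary points has visible geodesics. -/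
def HasVisibleGeodesics {n : ℕ} (D : Set (EuclideanSpace ℂ (Fin n)))
    (p q : EuclideanSpace ℂ (Fin n)) : Prop :=
  ∃ U ∈ 𝓝 p, ∃ V ∈ 𝓝 q, Disjoint (closure U) (closure V) ∧
    ∃ K : Set (EuclideanSpace ℂ (Fin n)), IsCompact K ∧ K ⊆ D ∧
      ∀ (L : ℝ) (σ : ℝ → EuclideanSpace ℂ (Fin n)), 0 ≤ L → IsKobayashiGeodesic D L σ →
        σ 0 ∈ U → σ L ∈ V → (σ '' Icc 0 L ∩ K).Nonempty

/-- The visibility property: every pair of distinct boundary points has visible geodesics. -/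
def HasVisibilityProperty {n : ℕ} (D : Set (EuclideanSpace ℂ (Fin n))) : Prop :=
  ∀ p ∈ frontier D, ∀ q ∈ frontier D, p ≠ q → HasVisibleGeodesics D p q

/-- `D` has `C^∞` boundary: near each boundary point, `D` is the sublevel set `{ρ < 0}` of a
smooth real function with nonvanishing differential at that point. -/
def HasSmoothBoundary {n : ℕ} (D : Set (EuclideanSpace ℂ (Fin n))) : Prop :=
  ∀ x ∈ frontier D, ∃ (U : Set (EuclideanSpace ℂ (Fin n))) (ρ : EuclideanSpace ℂ (Fin n) → ℝ),
    IsOpen U ∧ x ∈ U ∧ ContDiffOn ℝ ∞ ρ U ∧ fderiv ℝ ρ x ≠ 0 ∧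
      D ∩ U = {z | z ∈ U ∧ ρ z < 0}

/-- Smooth, even, nonnegative functions on `ℝ` that vanish at `0` and are strictly increasing
on `[0, ∞)`. -/
structure IsProfile (f : ℝ → ℝ) : Prop where
  contDiff : ContDiff ℝ ∞ f
  even : ∀ x, f (-x) = f x
  nonneg : ∀ x, 0 ≤ f x
  map_zero : f 0 = 0
  strictMonoOn : StrictMonoOn f (Ici 0)

/-- `Ω` is a smoothly bounded convex domain in `ℂ²`, contained in the ball `B(0,5)`, which inside
the ball `B(0,3)` is given by
`Re z₂ > ψ(Re z₁) + χ₁((|Im z₁| - 2)₊) + χ₂(Im z₂)`. The coordinates `z₁, z₂` are `z 0, z 1`. -/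
structure IsModelDomain (ψ χ₁ χ₂ : ℝ → ℝ) (Ω : Set (EuclideanSpace ℂ (Fin 2))) : Prop where
  isOpen : IsOpen Ω
  convex : Convex ℝ Ω
  smoothBoundary : HasSmoothBoundary Ω
  subset_ball : Ω ⊆ Metric.ball 0 5
  inter_ball : Ω ∩ {z | ‖z‖ < 3} =
    {z | ‖z‖ < 3 ∧ (z 1).re > ψ (z 0).re + χ₁ (max (|(z 0).im| - 2) 0) + χ₂ (z 1).im}

end

/-!
If the geodesics joining points near `p` to points near `q` all meet a compact set `K`, then
`(p'|q')_o` is at most the largest distance from `o` to `K`; the geodesics exist because the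
Kobayashi distance of a bounded convex domain is proper.

Here the Gromov product is unbounded. Since `Re z₂ > 0` on the domain, comparison with the half
plane gives `k(o, (±i, ψ(x))) ≥ -log ψ(x) / 2 - C`. On the other hand `(i, ψ(x))` and `(-i, ψ(x))`
lie in a flat channel of width `2x`, so comparison with the hyperbolic metric on the axis of a strip
bounds their distance by `π / (2x) + 2`. Hence the Gromov product is at least
`(-log ψ(x) - π / (2x)) / 2 - C'`, and this tends to infinity precisely when
`ψ(x) = o(exp(-π / (2x)))`.
-/

section KobayashiRoyden

variable {n : ℕ} {D : Set (EuclideanSpace ℂ (Fin n))} {z X : EuclideanSpace ℂ (Fin n)}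

theorem kobayashiRoyden_nonneg : 0 ≤ kobayashiRoyden D z X :=
  Real.sInf_nonneg (by rintro r ⟨α, φ, -, -, -, -, rfl⟩; exact norm_nonneg α)

theorem kobayashiRoyden_le {α : ℂ} {φ : ℂ → EuclideanSpace ℂ (Fin n)}
    (hd : DifferentiableOn ℂ φ (Metric.ball 0 1)) (hm : MapsTo φ (Metric.ball 0 1) D)
    (h0 : φ 0 = z) (hX : α • deriv φ 0 = X) : kobayashiRoyden D z X ≤ ‖α‖ :=
  csInf_le ⟨0, by rintro r ⟨α, φ, -, -, -, -, rfl⟩; exact norm_nonneg α⟩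
    ⟨α, φ, hd, hm, h0, hX, rfl⟩

theorem kobayashiRoyden_zero : kobayashiRoyden D z 0 = 0 := by
  by_cases h : ∃ φ : ℂ → EuclideanSpace ℂ (Fin n), DifferentiableOn ℂ φ (Metric.ball 0 1) ∧
      MapsTo φ (Metric.ball 0 1) D ∧ φ 0 = z
  · obtain ⟨φ, hd, hm, h0⟩ := h
    refine le_antisymm ?_ kobayashiRoyden_nonneg
    simpa only [norm_zero] using kobayashiRoyden_le hd hm h0 (zero_smul ℂ _)
  · -- Without a disc through `z` the metric is the junk value `sInf ∅ = 0`.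
    refine (congrArg sInf (eq_empty_of_forall_notMem ?_)).trans Real.sInf_empty
    rintro r ⟨α, φ, hd, hm, h0, -, -⟩
    exact h ⟨φ, hd, hm, h0⟩

open scoped Pointwise in
theorem kobayashiRoyden_smul (c : ℂ) :
    kobayashiRoyden D z (c • X) = ‖c‖ * kobayashiRoyden D z X := by
  rcases eq_or_ne c 0 with rfl | hc
  · rw [zero_smul, kobayashiRoyden_zero, norm_zero, zero_mul]
  rw [kobayashiRoyden, kobayashiRoyden, ← smul_eq_mul, ← Real.sInf_smul_of_nonneg (norm_nonneg c)]
  congr 1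
  ext r
  constructor
  · rintro ⟨α, φ, hd, hm, h0, hX, rfl⟩
    refine ⟨‖c⁻¹ * α‖, ⟨c⁻¹ * α, φ, hd, hm, h0, ?_, rfl⟩, ?_⟩
    · rw [mul_smul, hX, inv_smul_smul₀ hc]
    · simp only [smul_eq_mul, norm_mul, norm_inv]
      exact mul_inv_cancel_left₀ (norm_ne_zero_iff.2 hc) _
  · rintro ⟨_, ⟨α, φ, hd, hm, h0, hX, rfl⟩, rfl⟩
    exact ⟨c * α, φ, hd, hm, h0, by rw [mul_smul, hX], (norm_mul c α).symm⟩

theorem exists_disc_of_ball_subset {r : ℝ} (hr : 0 < r) (hD : Metric.ball z r ⊆ D)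
    (X : EuclideanSpace ℂ (Fin n)) :
    ∃ (α : ℂ) (φ : ℂ → EuclideanSpace ℂ (Fin n)), DifferentiableOn ℂ φ (Metric.ball 0 1) ∧
      MapsTo φ (Metric.ball 0 1) D ∧ φ 0 = z ∧ α • deriv φ 0 = X ∧ ‖α‖ = ‖X‖ / r := by
  set v := ((r / ‖X‖ : ℝ) : ℂ) • X
  have hv : ‖v‖ ≤ r := by
    rw [norm_smul, Complex.norm_real, Real.norm_of_nonneg (by positivity), div_mul_eq_mul_div,
      mul_div_assoc]
    exact mul_le_of_le_one_right hr.le (div_self_le_one ‖X‖)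
  have hderiv : HasDerivAt (fun ζ : ℂ => z + ζ • v) v 0 := by
    simpa using ((hasDerivAt_id (0 : ℂ)).smul_const v).const_add z
  refine ⟨((‖X‖ / r : ℝ) : ℂ), fun ζ => z + ζ • v, by fun_prop, fun ζ hζ => hD ?_, by simp, ?_, ?_⟩
  · rw [mem_ball_zero_iff] at hζ
    rw [mem_ball_iff_norm, add_sub_cancel_left, norm_smul]
    nlinarith [norm_nonneg ζ]
  · rw [hderiv.deriv, smul_smul, ← Complex.ofReal_mul, div_mul_div_comm, mul_comm ‖X‖]
    rcases eq_or_ne X 0 with rfl | hX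
    · exact smul_zero _
    · rw [div_self (mul_ne_zero hr.ne' (norm_ne_zero_iff.2 hX)), Complex.ofReal_one, one_smul]
  · rw [Complex.norm_real, Real.norm_of_nonneg (by positivity)]

theorem kobayashiRoyden_le_of_ball_subset {r : ℝ} (hr : 0 < r) (hD : Metric.ball z r ⊆ D) :
    kobayashiRoyden D z X ≤ ‖X‖ / r := by
  obtain ⟨α, φ, hd, hm, h0, hX, hα⟩ := exists_disc_of_ball_subset hr hD X
  exact (kobayashiRoyden_le hd hm h0 hX).trans_eq hα

theorem norm_map_le_mul_kobayashiRoyden {G : Type*} [SeminormedAddCommGroup G] [NormedSpace ℂ G]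
    (hD : IsOpen D) (hz : z ∈ D) (T : EuclideanSpace ℂ (Fin n) →ₗ[ℂ] G) {M : ℝ}
    (hT : ∀ φ : ℂ → EuclideanSpace ℂ (Fin n), DifferentiableOn ℂ φ (Metric.ball 0 1) →
      MapsTo φ (Metric.ball 0 1) D → φ 0 = z → ‖T (deriv φ 0)‖ ≤ M) :
    ‖T X‖ ≤ M * kobayashiRoyden D z X := by
  obtain ⟨r, hr, hrD⟩ := Metric.isOpen_iff.1 hD z hz
  obtain ⟨α₀, φ₀, hd₀, hm₀, h₀, hX₀, -⟩ := exists_disc_of_ball_subset hr hrD X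
  have hM : 0 ≤ M := (norm_nonneg _).trans (hT φ₀ hd₀ hm₀ h₀)
  rw [kobayashiRoyden, ← smul_eq_mul, ← Real.sInf_smul_of_nonneg hM]
  refine le_csInf ⟨_, _, ⟨α₀, φ₀, hd₀, hm₀, h₀, hX₀, rfl⟩, rfl⟩ ?_
  rintro _ ⟨_, ⟨α, φ, hd, hm, h0, hX, rfl⟩, rfl⟩
  calc ‖T X‖ = ‖T (deriv φ 0)‖ * ‖α‖ := by rw [← hX, map_smul, norm_smul, mul_comm]
    _ ≤ M * ‖α‖ := by gcongr; exact hT φ hd hm h0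

theorem norm_le_diam_mul_kobayashiRoyden (hD : IsOpen D) (hb : Bornology.IsBounded D)
    (hz : z ∈ D) : ‖X‖ ≤ Metric.diam D * kobayashiRoyden D z X := by
  refine norm_map_le_mul_kobayashiRoyden hD hz LinearMap.id fun φ hd hm h0 => ?_
  rw [LinearMap.id_apply, ← div_one (Metric.diam D)]
  refine Complex.norm_deriv_le_div_of_mapsTo_ball hd (fun ζ hζ => ?_) one_pos
  exact Metric.mem_closedBall.2 (Metric.dist_le_diam_of_mem hb (hm hζ) (h0 ▸ hz))

/- Schwarz's lemma for the composition of `f` with the Cayley transform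
`w ↦ (w - f 0) / (w + conj (f 0))`. -/
theorem norm_deriv_le_two_mul_re {f : ℂ → ℂ} (hd : DifferentiableOn ℂ f (Metric.ball 0 1))
    (hre : ∀ ζ ∈ Metric.ball (0 : ℂ) 1, 0 < (f ζ).re) : ‖deriv f 0‖ ≤ 2 * (f 0).re := by
  have h0 : (0 : ℂ) ∈ Metric.ball (0 : ℂ) 1 := Metric.mem_ball_self one_pos
  set a := f 0
  set a' := starRingEnd ℂ a
  have hne : ∀ ζ ∈ Metric.ball (0 : ℂ) 1, f ζ + a' ≠ 0 := fun ζ hζ h => by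
    have := congrArg Complex.re h
    rw [Complex.add_re, Complex.conj_re, Complex.zero_re] at this
    linarith [hre ζ hζ, hre 0 h0]
  have ha : a + a' = ((2 * a.re : ℝ) : ℂ) := by rw [Complex.add_conj]
  have hda := (hd.differentiableAt (Metric.ball_mem_nhds 0 one_pos)).hasDerivAt
  have hg : HasDerivAt (fun ζ => (f ζ - a) / (f ζ + a')) (deriv f 0 / (a + a')) 0 := by
    refine ((hda.sub_const a).div (hda.add_const a') (hne 0 h0)).congr_deriv ?_
    rw [sub_self, zero_mul, sub_zero, sq, mul_div_mul_right _ _ (hne 0 h0)]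
  have hnorm : ∀ ζ ∈ Metric.ball (0 : ℂ) 1, ‖(f ζ - a) / (f ζ + a')‖ ≤ 1 := fun ζ hζ => by
    rw [norm_div, div_le_one (norm_pos_iff.2 (hne ζ hζ)),
      ← sq_le_sq₀ (norm_nonneg _) (norm_nonneg _), Complex.sq_norm, Complex.sq_norm,
      Complex.normSq_apply, Complex.normSq_apply, Complex.sub_re, Complex.sub_im, Complex.add_re,
      Complex.add_im, Complex.conj_re, Complex.conj_im]
    nlinarith [mul_pos (hre ζ hζ) (hre 0 h0)]
  have key := Complex.norm_deriv_le_one_of_mapsTo_ball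
    (f := fun ζ => (f ζ - a) / (f ζ + a')) ((hd.sub_const a).div (hd.add_const a') hne)
    (fun ζ hζ => by simpa [a] using hnorm ζ hζ) one_pos
  rwa [hg.deriv, ha, norm_div, Complex.norm_real, Real.norm_of_nonneg (by linarith [hre 0 h0]),
    div_le_one (by linarith [hre 0 h0])] at key

theorem norm_fderiv_le_re_mul_kobayashiRoyden (hD : IsOpen D) {f : EuclideanSpace ℂ (Fin n) → ℂ}
    (hf : DifferentiableOn ℂ f D) (hre : ∀ w ∈ D, 0 < (f w).re) (hz : z ∈ D) :
    ‖fderiv ℂ f z X‖ ≤ 2 * (f z).re * kobayashiRoyden D z X := by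
  refine norm_map_le_mul_kobayashiRoyden hD hz (fderiv ℂ f z).toLinearMap fun φ hd hm h0 => ?_
  have hφ := (hd.differentiableAt (Metric.ball_mem_nhds 0 one_pos)).hasDerivAt
  have hfz := (hf.differentiableAt (hD.mem_nhds hz)).hasFDerivAt
  have hcomp : deriv (f ∘ φ) 0 = fderiv ℂ f z (deriv φ 0) :=
    (hfz.comp_hasDerivAt_of_eq 0 hφ h0.symm).deriv
  have key := norm_deriv_le_two_mul_re (hf.comp hd hm) fun ζ hζ => hre _ (hm hζ)
  rwa [hcomp, Function.comp_apply, h0] at key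

end KobayashiRoyden

section Curves

/-- `PiecewiseC1 γ a b`: the curve `γ` is piecewise `C¹` on `[a, b]`. Being inductive in the right
endpoint, it lets curves be cut, concatenated and measured one smooth piece at a time. -/
inductive PiecewiseC1 {E : Type*} [NormedAddCommGroup E] [NormedSpace ℝ E] (γ : ℝ → E)
    (a : ℝ) : ℝ → Prop
  | refl : PiecewiseC1 γ a a
  | snoc {b c : ℝ} : PiecewiseC1 γ a b → b ≤ c → ContDiffOn ℝ 1 γ (Icc b c) →
      PiecewiseC1 γ a c

namespace PiecewiseC1

variable {E : Type*} [NormedAddCommGroup E] [NormedSpace ℝ E] {γ γ' : ℝ → E} {a b c : ℝ}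

theorem le (h : PiecewiseC1 γ a b) : a ≤ b := by
  induction h with
  | refl => exact le_rfl
  | snoc _ hbc _ ih => exact ih.trans hbc

theorem of_contDiffOn (hab : a ≤ b) (h : ContDiffOn ℝ 1 γ (Icc a b)) : PiecewiseC1 γ a b :=
  snoc refl hab h

theorem trans (h₁ : PiecewiseC1 γ a b) (h₂ : PiecewiseC1 γ b c) : PiecewiseC1 γ a c := by
  induction h₂ with
  | refl => exact h₁
  | snoc _ hbc hd ih => exact snoc ih hbc hd

theorem continuousOn (h : PiecewiseC1 γ a b) : ContinuousOn γ (Icc a b) := by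
  induction h with
  | refl => simp
  | snoc h hbc hd ih =>
    rw [← Icc_union_Icc_eq_Icc h.le hbc]
    exact ih.union_of_isClosed hd.continuousOn isClosed_Icc isClosed_Icc

theorem split (h : PiecewiseC1 γ a b) {s : ℝ} (hs : s ∈ Icc a b) :
    PiecewiseC1 γ a s ∧ PiecewiseC1 γ s b := by
  induction h with
  | refl =>
    obtain rfl : s = a := le_antisymm hs.2 hs.1
    exact ⟨refl, refl⟩
  | @snoc b c h hbc hd ih =>
    rcases le_total s b with hsb | hsb
    · exact ⟨(ih ⟨hs.1, hsb⟩).1, snoc (ih ⟨hs.1, hsb⟩).2 hbc hd⟩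
    · exact ⟨snoc h hsb (hd.mono (Icc_subset_Icc le_rfl hs.2)),
        of_contDiffOn hs.2 (hd.mono (Icc_subset_Icc hsb le_rfl))⟩

theorem congr (h : PiecewiseC1 γ a b) (hγ : EqOn γ' γ (Icc a b)) : PiecewiseC1 γ' a b := by
  induction h with
  | refl => exact refl
  | snoc h hbc hd ih =>
    exact snoc (ih (hγ.mono (Icc_subset_Icc le_rfl hbc))) hbc
      (hd.congr (hγ.mono (Icc_subset_Icc h.le le_rfl)))

theorem ite {γ₁ γ₂ : ℝ → E} (h₁ : PiecewiseC1 γ₁ a b) (h₂ : PiecewiseC1 γ₂ b c) (h : γ₁ b = γ₂ b) :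
    PiecewiseC1 (fun t => if t ≤ b then γ₁ t else γ₂ t) a c := by
  refine (h₁.congr fun t ht => if_pos ht.2).trans (h₂.congr fun t ht => ?_)
  rcases ht.1.eq_or_lt with rfl | hlt
  · exact (if_pos le_rfl).trans h
  · exact if_neg hlt.not_ge

theorem comp_affine (h : PiecewiseC1 γ a b) {m : ℝ} (hm : 0 < m) (d : ℝ) :
    PiecewiseC1 (fun t => γ (m * t + d)) ((a - d) / m) ((b - d) / m) := by
  induction h with
  | refl => exact refl
  | @snoc b c _ hbc hd ih =>
    refine snoc ih (by gcongr) (hd.comp (t := Icc b c) (by fun_prop) fun t ht => ?_)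
    rw [mem_Icc, div_le_iff₀' hm, le_div_iff₀' hm] at ht
    constructor <;> linarith [ht.1, ht.2]

theorem comp_neg (h : PiecewiseC1 γ a b) : PiecewiseC1 (fun t => γ (-t)) (-b) (-a) := by
  induction h with
  | refl => exact refl
  | @snoc b c _ hbc hd ih =>
    refine (of_contDiffOn (by linarith) (hd.comp (t := Icc b c) (by fun_prop) fun t ht => ?_)).trans
      ih
    constructor <;> linarith [ht.1, ht.2]

theorem exists_partition (h : PiecewiseC1 γ a b) :
    ∃ (N : ℕ) (t : ℕ → ℝ), Monotone t ∧ t 0 = a ∧ t N = b ∧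
      ∀ i < N, ContDiffOn ℝ 1 γ (Icc (t i) (t (i + 1))) := by
  induction h with
  | refl => exact ⟨0, fun _ => a, monotone_const, rfl, rfl, by simp⟩
  | @snoc b c _ hbc hd ih =>
    obtain ⟨N, t, ht, h0, hN, hi⟩ := ih
    refine ⟨N + 1, fun i => if i ≤ N then t i else c, ?_, by simp [h0], by simp, ?_⟩
    · intro i j hij
      dsimp only
      split_ifs with h1 h2
      · exact ht hij
      · exact (ht h1).trans (hN.trans_le hbc)
      · omega
      · exact le_rfl
    · intro i hiN
      rcases eq_or_lt_of_le (Nat.lt_succ_iff.1 hiN) with rfl | hlt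
      · simpa [hN] using hd
      · have h1 : i ≤ N := hlt.le
        have h2 : i + 1 ≤ N := hlt
        simpa [h1, h2] using hi i hlt

theorem of_partition {N : ℕ} {t : ℕ → ℝ} (ht : Monotone t)
    (hi : ∀ i < N, ContDiffOn ℝ 1 γ (Icc (t i) (t (i + 1)))) : PiecewiseC1 γ (t 0) (t N) := by
  induction N with
  | zero => exact refl
  | succ N ih =>
    exact snoc (ih fun i h => hi i (h.trans N.lt_succ_self)) (ht N.le_succ) (hi N N.lt_succ_self)

end PiecewiseC1

variable {n : ℕ} {D : Set (EuclideanSpace ℂ (Fin n))} {x y : EuclideanSpace ℂ (Fin n)}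
  {γ γ' : ℝ → EuclideanSpace ℂ (Fin n)} {a b c : ℝ}

theorem isPiecewiseC1Curve_iff : IsPiecewiseC1Curve D x y γ ↔
    PiecewiseC1 γ 0 1 ∧ MapsTo γ (Icc 0 1) D ∧ γ 0 = x ∧ γ 1 = y := by
  constructor
  · rintro ⟨-, hm, h0, h1, N, t, ht, ht0, htN, hi⟩
    exact ⟨ht0 ▸ htN ▸ PiecewiseC1.of_partition ht hi, hm, h0, h1⟩
  · rintro ⟨h, hm, h0, h1⟩
    exact ⟨h.continuousOn, hm, h0, h1, h.exists_partition⟩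

/-- The Kobayashi–Royden length of the part of `γ` over `s`. For a curve on `[a, b]` we take
`s = Ioo a b`, where `deriv γ` does not depend on the values of `γ` outside `[a, b]`. -/
noncomputable def kobayashiLength (D : Set (EuclideanSpace ℂ (Fin n)))
    (γ : ℝ → EuclideanSpace ℂ (Fin n)) (s : Set ℝ) : ℝ≥0∞ :=
  ∫⁻ t in s, ENNReal.ofReal (kobayashiRoyden D (γ t) (deriv γ t))

theorem kobayashiLength_congr {s : Set ℝ} (hs : IsOpen s) (h : EqOn γ γ' s) :
    kobayashiLength D γ s = kobayashiLength D γ' s := by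
  refine setLIntegral_congr_fun hs.measurableSet fun t ht => ?_
  have h' : γ =ᶠ[𝓝 t] γ' := h.eventuallyEq_of_mem (hs.mem_nhds ht)
  simp only [h ht, h'.deriv_eq]

theorem kobayashiLength_add (hab : a ≤ b) (hbc : b ≤ c) :
    kobayashiLength D γ (Ioo a b) + kobayashiLength D γ (Ioo b c) =
      kobayashiLength D γ (Ioo a c) := by
  simp only [kobayashiLength, restrict_Ioo_eq_restrict_Ioc]
  rw [← Ioc_union_Ioc_eq_Ioc hab hbc,
    lintegral_union measurableSet_Ioc (Ioc_disjoint_Ioc_of_le le_rfl)]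

theorem kobayashiLength_comp_affine {m : ℝ} (hm : m ≠ 0) (d : ℝ) {s : Set ℝ}
    (hs : MeasurableSet s) :
    kobayashiLength D (fun t => γ (m * t + d)) s =
      kobayashiLength D γ ((fun t => m * t + d) '' s) := by
  rw [kobayashiLength, kobayashiLength,
    lintegral_image_eq_lintegral_abs_deriv_mul hs (f' := fun _ => m)
      (fun t _ => by simpa using (((hasDerivAt_id t).const_mul m).add_const d).hasDerivWithinAt)
      (fun t _ t' _ h => by simpa [hm] using h)]
  congr 1 with t
  have hder : deriv (fun t => γ (m * t + d)) t = (m : ℂ) • deriv γ (m * t + d) := by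
    rw [deriv_comp_mul_left m (fun u => γ (u + d)) t, deriv_comp_add_const, Complex.coe_smul]
  rw [hder, kobayashiRoyden_smul, Complex.norm_real, Real.norm_eq_abs,
    ENNReal.ofReal_mul (abs_nonneg m)]

theorem kobayashiEDist_le_of_unitInterval (h : PiecewiseC1 γ 0 1) (hγ : MapsTo γ (Icc 0 1) D) :
    kobayashiEDist D (γ 0) (γ 1) ≤ kobayashiLength D γ (Ioo 0 1) := by
  refine (iInf₂_le γ (isPiecewiseC1Curve_iff.2 ⟨h, hγ, rfl, rfl⟩)).trans_eq ?_
  rw [kobayashiLength, restrict_Ioo_eq_restrict_Icc]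

theorem kobayashiEDist_self (hx : x ∈ D) : kobayashiEDist D x x = 0 := by
  have h := kobayashiEDist_le_of_unitInterval (D := D) (γ := fun _ => x)
    (.of_contDiffOn zero_le_one contDiffOn_const) (fun _ _ => hx)
  simpa [kobayashiLength, kobayashiRoyden_zero] using h

theorem kobayashiEDist_le_kobayashiLength (h : PiecewiseC1 γ a b) (hγ : MapsTo γ (Icc a b) D) :
    kobayashiEDist D (γ a) (γ b) ≤ kobayashiLength D γ (Ioo a b) := by
  rcases h.le.eq_or_lt with rfl | hab
  · rw [kobayashiEDist_self (hγ (left_mem_Icc.2 le_rfl))]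
    exact zero_le
  have hm : 0 < b - a := sub_pos.2 hab
  have h1 := h.comp_affine hm a
  rw [sub_self, zero_div, div_self hm.ne'] at h1
  have h2 := kobayashiEDist_le_of_unitInterval (D := D) h1 fun t ht =>
    hγ ⟨by nlinarith [ht.1], by nlinarith [ht.2]⟩
  rw [kobayashiLength_comp_affine hm.ne' a measurableSet_Ioo, image_affine_Ioo hm] at h2
  simpa only [mul_zero, zero_add, mul_one, sub_add_cancel] using h2

theorem kobayashiEDist_lt_iff {r : ℝ≥0∞} (hab : a < b) : kobayashiEDist D x y < r ↔
    ∃ γ : ℝ → EuclideanSpace ℂ (Fin n), PiecewiseC1 γ a b ∧ MapsTo γ (Icc a b) D ∧ γ a = x ∧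
      γ b = y ∧ kobayashiLength D γ (Ioo a b) < r := by
  refine ⟨fun h => ?_, ?_⟩
  · simp only [kobayashiEDist, iInf_lt_iff, isPiecewiseC1Curve_iff,
      ← restrict_Ioo_eq_restrict_Icc] at h
    obtain ⟨γ, ⟨hp, hm, h0, h1⟩, hlt⟩ := h
    obtain ⟨m, d, hm0, hma, hmb⟩ : ∃ m d : ℝ, 0 < m ∧ m * a + d = 0 ∧ m * b + d = 1 := by
      refine ⟨(b - a)⁻¹, -((b - a)⁻¹ * a), inv_pos.2 (sub_pos.2 hab), add_neg_cancel _, ?_⟩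
      rw [← sub_eq_add_neg, ← mul_sub, inv_mul_cancel₀ (sub_pos.2 hab).ne']
    refine ⟨fun t => γ (m * t + d), ?_, fun t ht => hm ⟨?_, ?_⟩, ?_, ?_, ?_⟩
    · convert hp.comp_affine hm0 d using 1
      · rw [eq_div_iff hm0.ne']; linarith
      · rw [eq_div_iff hm0.ne']; linarith
    · exact hma ▸ add_le_add_left (mul_le_mul_of_nonneg_left ht.1 hm0.le) d
    · exact hmb ▸ add_le_add_left (mul_le_mul_of_nonneg_left ht.2 hm0.le) d
    · simp only [hma, h0]
    · simp only [hmb, h1]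
    · rwa [kobayashiLength_comp_affine hm0.ne' d measurableSet_Ioo, image_affine_Ioo hm0, hma, hmb]
  · rintro ⟨γ, hp, hm, rfl, rfl, hlt⟩
    exact (kobayashiEDist_le_kobayashiLength hp hm).trans_lt hlt

theorem kobayashiEDist_comm (x y : EuclideanSpace ℂ (Fin n)) :
    kobayashiEDist D x y = kobayashiEDist D y x := by
  suffices ∀ x y, kobayashiEDist D x y ≤ kobayashiEDist D y x from le_antisymm (this x y) (this y x)
  intro x y
  refine le_of_forall_gt fun r hr => ?_
  obtain ⟨γ, h, hm, rfl, rfl, hl⟩ := (kobayashiEDist_lt_iff zero_lt_one).1 hr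
  have key := kobayashiEDist_le_kobayashiLength h.comp_neg
    (fun t ht => hm ⟨by linarith [ht.2], by linarith [ht.1]⟩)
  have hl' := kobayashiLength_comp_affine (D := D) (γ := γ) (neg_ne_zero.2 one_ne_zero) 0
    (measurableSet_Ioo (a := -1) (b := -0))
  simp only [neg_mul, one_mul, add_zero, image_neg_eq_neg, neg_Ioo, neg_neg, neg_zero] at hl' key
  exact key.trans_lt (hl' ▸ hl)

theorem kobayashiEDist_triangle (x y z : EuclideanSpace ℂ (Fin n)) :
    kobayashiEDist D x z ≤ kobayashiEDist D x y + kobayashiEDist D y z := by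
  refine ENNReal.le_of_forall_pos_le_add fun ε hε hlt => ?_
  have hε' : (ε / 2 : ℝ≥0∞) ≠ 0 := by simpa using hε.ne'
  rw [ENNReal.add_lt_top] at hlt
  obtain ⟨γ₁, h₁, hm₁, rfl, rfl, hl₁⟩ :=
    (kobayashiEDist_lt_iff zero_lt_one).1 (ENNReal.lt_add_right hlt.1.ne hε')
  obtain ⟨γ₂, h₂, hm₂, h₁₂, rfl, hl₂⟩ :=
    (kobayashiEDist_lt_iff one_lt_two).1 (ENNReal.lt_add_right hlt.2.ne hε')
  have hm : MapsTo (fun t => if t ≤ 1 then γ₁ t else γ₂ t) (Icc 0 2) D := fun t ht => by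
    dsimp only
    split_ifs with h
    · exact hm₁ ⟨ht.1, h⟩
    · exact hm₂ ⟨(not_le.1 h).le, ht.2⟩
  have key := kobayashiEDist_le_kobayashiLength (h₁.ite h₂ h₁₂.symm) hm
  rw [if_pos zero_le_one, if_neg one_lt_two.not_ge, ← kobayashiLength_add zero_le_one one_le_two,
    kobayashiLength_congr isOpen_Ioo fun t ht => if_pos ht.2.le,
    kobayashiLength_congr isOpen_Ioo fun t ht => if_neg ht.1.not_ge] at key
  refine key.trans ((add_le_add hl₁.le hl₂.le).trans_eq ?_)
  rw [add_add_add_comm, ENNReal.add_halves]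

end Curves

section Distance

open scoped NNReal

variable {n : ℕ} {D : Set (EuclideanSpace ℂ (Fin n))} {x y z : EuclideanSpace ℂ (Fin n)}
  {γ : ℝ → EuclideanSpace ℂ (Fin n)} {a b : ℝ}

theorem kobayashiEDist_le_of_segment {M : ℝ} (hs : ∀ t ∈ Icc (0 : ℝ) 1,
      AffineMap.lineMap x y t ∈ D ∧ kobayashiRoyden D (AffineMap.lineMap x y t) (y - x) ≤ M) :
    kobayashiEDist D x y ≤ ENNReal.ofReal M := by
  have h := kobayashiEDist_le_kobayashiLength (D := D)
    (.of_contDiffOn zero_le_one (AffineMap.contDiff_lineMap x y).contDiffOn) fun t ht => (hs t ht).1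
  rw [AffineMap.lineMap_apply_zero, AffineMap.lineMap_apply_one] at h
  calc kobayashiEDist D x y ≤ ∫⁻ _ in Ioo (0 : ℝ) 1, ENNReal.ofReal M :=
      h.trans <| setLIntegral_mono' measurableSet_Ioo fun t ht => by
        rw [AffineMap.hasDerivAt_lineMap.deriv]
        exact ENNReal.ofReal_le_ofReal (hs t (Ioo_subset_Icc_self ht)).2
    _ = ENNReal.ofReal M := by
      rw [setLIntegral_const, Real.volume_Ioo, sub_zero, ENNReal.ofReal_one, mul_one]

theorem tendsto_kobayashiEDist_self (hD : D ∈ 𝓝 x) :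
    Tendsto (kobayashiEDist D x) (𝓝 x) (𝓝 0) := by
  obtain ⟨r, hr, hrD⟩ := Metric.mem_nhds_iff.1 hD
  have hlim : Tendsto (fun w => ENNReal.ofReal (‖w - x‖ / (r / 2))) (𝓝 x) (𝓝 0) := by
    have : Continuous fun w => ENNReal.ofReal (‖w - x‖ / (r / 2)) :=
      ENNReal.continuous_ofReal.comp (by fun_prop)
    simpa using this.tendsto x
  refine tendsto_of_tendsto_of_tendsto_of_le_of_le' tendsto_const_nhds hlim
    (.of_forall fun _ => zero_le) ?_
  filter_upwards [Metric.ball_mem_nhds x (half_pos hr)] with w hw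
  refine kobayashiEDist_le_of_segment fun t ht => ?_
  have hmem := (convex_ball x (r / 2)).lineMap_mem (Metric.mem_ball_self (half_pos hr)) hw ht
  have hball : Metric.ball (AffineMap.lineMap x w t) (r / 2) ⊆ D :=
    (Metric.ball_subset_ball' (by linarith [Metric.mem_ball.1 hmem])).trans hrD
  exact ⟨hball (Metric.mem_ball_self (half_pos hr)),
    kobayashiRoyden_le_of_ball_subset (half_pos hr) hball⟩

theorem kobayashiEDist_ne_top (hD : IsOpen D) (hc : IsPreconnected D) (hx : x ∈ D) (hy : y ∈ D) :
    kobayashiEDist D x y ≠ ⊤ := by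
  refine hc.induction₂ (fun x y => kobayashiEDist D x y ≠ ⊤) (fun x hx => ?_) ?_ ?_ hx hy
  · filter_upwards [nhdsWithin_le_nhds <| (tendsto_kobayashiEDist_self (hD.mem_nhds hx)).eventually
      (gt_mem_nhds ENNReal.zero_lt_top)] with w hw using hw.ne
  · exact fun x y z _ _ _ hxy hyz =>
      ne_top_of_le_ne_top (ENNReal.add_ne_top.2 ⟨hxy, hyz⟩) (kobayashiEDist_triangle x y z)
  · exact fun x y _ _ hxy => kobayashiEDist_comm x y ▸ hxy

theorem kobayashiDist_self (hx : x ∈ D) : kobayashiDist D x x = 0 := by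
  rw [kobayashiDist, kobayashiEDist_self hx, ENNReal.toReal_zero]

theorem kobayashiDist_nonneg : 0 ≤ kobayashiDist D x y := ENNReal.toReal_nonneg

theorem kobayashiDist_comm (x y : EuclideanSpace ℂ (Fin n)) :
    kobayashiDist D x y = kobayashiDist D y x := by
  rw [kobayashiDist, kobayashiEDist_comm, kobayashiDist]

theorem kobayashiDist_triangle (hD : IsOpen D) (hc : IsPreconnected D) (hx : x ∈ D) (hy : y ∈ D)
    (hz : z ∈ D) : kobayashiDist D x z ≤ kobayashiDist D x y + kobayashiDist D y z := by
  have h1 := kobayashiEDist_ne_top hD hc hx hy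
  have h2 := kobayashiEDist_ne_top hD hc hy hz
  rw [kobayashiDist, kobayashiDist, kobayashiDist, ← ENNReal.toReal_add h1 h2]
  exact ENNReal.toReal_mono (ENNReal.add_ne_top.2 ⟨h1, h2⟩) (kobayashiEDist_triangle x y z)

theorem enorm_sub_le_mul_kobayashiLength {G : Type*} [NormedAddCommGroup G] [NormedSpace ℝ G]
    (hD : IsOpen D) {F : EuclideanSpace ℂ (Fin n) → G} (hF : ContDiffOn ℝ 1 F D) {M : ℝ≥0}
    (hF' : ∀ z ∈ D, ∀ X, ‖fderiv ℝ F z X‖ ≤ M * kobayashiRoyden D z X)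
    (h : PiecewiseC1 γ a b) (hm : MapsTo γ (Icc a b) D) :
    ‖F (γ b) - F (γ a)‖ₑ ≤ M * kobayashiLength D γ (Ioo a b) := by
  induction h with
  | refl => simp only [sub_self, enorm_zero, zero_le]
  | @snoc b c h hbc hd ih =>
    have hmc : MapsTo γ (Icc b c) D := hm.mono_left (Icc_subset_Icc_left h.le)
    have hpiece := enorm_sub_le_lintegral_deriv_of_contDiffOn_Icc (hF.comp hd hmc) hbc
    rw [← kobayashiLength_add h.le hbc, ← sub_add_sub_cancel' (F (γ b)), mul_add]
    refine (enorm_add_le _ _).trans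
      (add_le_add (ih (hm.mono_left (Icc_subset_Icc_right hbc))) (hpiece.trans ?_))
    rw [kobayashiLength, ← restrict_Ioo_eq_restrict_Icc,
      ← lintegral_const_mul' _ _ ENNReal.coe_ne_top]
    refine setLIntegral_mono_ae' measurableSet_Ioo (ae_of_all _ fun t ht => ?_)
    have hmem := hmc (Ioo_subset_Icc_self ht)
    have hγt : DifferentiableAt ℝ γ t :=
      (hd.differentiableOn one_ne_zero).differentiableAt (Icc_mem_nhds ht.1 ht.2)
    have hFt : DifferentiableAt ℝ F (γ t) :=
      (hF.differentiableOn one_ne_zero).differentiableAt (hD.mem_nhds hmem)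
    rw [(hFt.hasFDerivAt.comp_hasDerivAt t hγt.hasDerivAt).deriv, ← ofReal_norm,
      ← ENNReal.ofReal_coe_nnreal, ← ENNReal.ofReal_mul M.coe_nonneg]
    exact ENNReal.ofReal_le_ofReal (hF' _ hmem _)

theorem norm_sub_le_mul_kobayashiDist {G : Type*} [NormedAddCommGroup G] [NormedSpace ℝ G]
    (hD : IsOpen D) (hc : IsPreconnected D) {F : EuclideanSpace ℂ (Fin n) → G}
    (hF : ContDiffOn ℝ 1 F D) {M : ℝ≥0}
    (hF' : ∀ z ∈ D, ∀ X, ‖fderiv ℝ F z X‖ ≤ M * kobayashiRoyden D z X) (hx : x ∈ D) (hy : y ∈ D) :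
    ‖F y - F x‖ ≤ M * kobayashiDist D x y := by
  have hfin := kobayashiEDist_ne_top hD hc hx hy
  have key : ‖F y - F x‖ₑ ≤ M * kobayashiEDist D x y := by
    refine ENNReal.le_mul_of_forall_lt (.inr hfin) (.inl ENNReal.coe_ne_top) fun M' hM' r hr => ?_
    obtain ⟨γ, h, hm, rfl, rfl, hl⟩ := (kobayashiEDist_lt_iff zero_lt_one).1 hr
    exact (enorm_sub_le_mul_kobayashiLength hD hF hF' h hm).trans (mul_le_mul' hM'.le hl.le)
  rw [← toReal_enorm, kobayashiDist, ← ENNReal.coe_toReal, ← ENNReal.toReal_mul]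
  exact ENNReal.toReal_mono (ENNReal.mul_ne_top ENNReal.coe_ne_top hfin) key

theorem norm_sub_le_diam_mul_kobayashiDist (hD : IsOpen D) (hc : IsPreconnected D)
    (hb : Bornology.IsBounded D) (hx : x ∈ D) (hy : y ∈ D) :
    ‖y - x‖ ≤ Metric.diam D * kobayashiDist D x y :=
  norm_sub_le_mul_kobayashiDist (M := ⟨Metric.diam D, Metric.diam_nonneg⟩) hD hc contDiffOn_id
    (fun z hz X => by rw [fderiv_id]; exact norm_le_diam_mul_kobayashiRoyden hD hb hz) hx hy

theorem abs_log_re_sub_log_re_le (hD : IsOpen D) (hc : IsPreconnected D)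
    {f : EuclideanSpace ℂ (Fin n) → ℂ} (hf : ContDiffOn ℂ 1 f D) (hre : ∀ w ∈ D, 0 < (f w).re)
    (hx : x ∈ D) (hy : y ∈ D) :
    |Real.log (f y).re - Real.log (f x).re| ≤ 2 * kobayashiDist D x y := by
  have hfd : DifferentiableOn ℂ f D := hf.differentiableOn one_ne_zero
  refine norm_sub_le_mul_kobayashiDist (F := fun w => Real.log (f w).re) (M := 2) hD hc
    ((Complex.reCLM.contDiff.comp_contDiffOn (hf.restrict_scalars ℝ)).log
      fun w hw => (hre w hw).ne') (fun w hw X => ?_) hx hy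
  have hpos := hre w hw
  have hder : fderiv ℝ (fun w => Real.log (f w).re) w X = (f w).re⁻¹ * (fderiv ℂ f w X).re := by
    have hfw := (hfd.differentiableAt (hD.mem_nhds hw)).hasFDerivAt.restrictScalars ℝ
    have hlog : HasFDerivAt (fun w => Real.log (f w).re) _ w :=
      (Complex.reCLM.hasFDerivAt.comp w hfw).log hpos.ne'
    rw [hlog.fderiv]
    rfl
  rw [hder, norm_mul, norm_inv, Real.norm_of_nonneg hpos.le, inv_mul_le_iff₀ hpos]
  calc ‖(fderiv ℂ f w X).re‖ ≤ ‖fderiv ℂ f w X‖ := Complex.abs_re_le_norm _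
    _ ≤ 2 * (f w).re * kobayashiRoyden D w X := norm_fderiv_le_re_mul_kobayashiRoyden hD hfd hre hw
    _ = (f w).re * (2 * kobayashiRoyden D w X) := by ring

end Distance

section ProperMetricSpace

variable {X : Type*} {x y : X}

theorem dist_eq_abs_sub_of_dist_le [PseudoMetricSpace X] {σ : ℝ → X} (h0 : σ 0 = x)
    (h1 : σ (dist x y) = y)
    (h : ∀ s ∈ Icc 0 (dist x y), ∀ t ∈ Icc 0 (dist x y), dist (σ s) (σ t) ≤ |s - t|) :
    ∀ s ∈ Icc 0 (dist x y), ∀ t ∈ Icc 0 (dist x y), dist (σ s) (σ t) = |s - t| := by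
  have hleft : (0 : ℝ) ∈ Icc 0 (dist x y) := left_mem_Icc.2 dist_nonneg
  have hright : dist x y ∈ Icc 0 (dist x y) := right_mem_Icc.2 dist_nonneg
  suffices ∀ s ∈ Icc 0 (dist x y), ∀ t ∈ Icc 0 (dist x y), s ≤ t → |s - t| ≤ dist (σ s) (σ t) from
    fun s hs t ht => le_antisymm (h s hs t ht) <| (le_total s t).elim (this s hs t ht) fun hts =>
      abs_sub_comm t s ▸ dist_comm (σ t) (σ s) ▸ this t ht s hs hts
  intro s hs t ht hst
  have hxs := h 0 hleft s hs
  have hty := h t ht _ hright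
  rw [h0, zero_sub, abs_neg, abs_of_nonneg hs.1] at hxs
  rw [h1, abs_sub_comm, abs_of_nonneg (sub_nonneg.2 ht.2)] at hty
  rw [abs_sub_comm, abs_of_nonneg (sub_nonneg.2 hst)]
  linarith [dist_triangle4 x (σ s) (σ t) y]

theorem exists_tendsto_ultrafilter_of_dist_le [PseudoMetricSpace X] [ProperSpace X] {ι : Type*}
    (l : Ultrafilter ι) {u : ι → X} {R : ℝ} (h : ∀ i, dist (u i) x ≤ R) :
    ∃ w, Tendsto u l (𝓝 w) := by
  have hu : ∀ᶠ i in l, u i ∈ Metric.closedBall x R := .of_forall h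
  obtain ⟨w, -, hw⟩ := (isCompact_closedBall x R).ultrafilter_le_nhds' (l.map u) hu
  exact ⟨w, hw⟩

/- The geodesic is the pointwise limit of approximate ones along a nonprincipal ultrafilter, which
spares the choice of subsequences. -/
theorem exists_geodesic_of_approx [MetricSpace X] [ProperSpace X]
    (h : ∀ ε > 0, ∃ σ : ℝ → X, dist (σ 0) x ≤ ε ∧ dist (σ (dist x y)) y ≤ ε ∧
      ∀ s ∈ Icc 0 (dist x y), ∀ t ∈ Icc 0 (dist x y), dist (σ s) (σ t) ≤ |s - t| + ε) :
    ∃ σ : ℝ → X, σ 0 = x ∧ σ (dist x y) = y ∧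
      ∀ s ∈ Icc 0 (dist x y), ∀ t ∈ Icc 0 (dist x y), dist (σ s) (σ t) = |s - t| := by
  have hleft : (0 : ℝ) ∈ Icc 0 (dist x y) := left_mem_Icc.2 dist_nonneg
  have hright : dist x y ∈ Icc 0 (dist x y) := right_mem_Icc.2 dist_nonneg
  have hε : Tendsto (fun n : ℕ => 1 / ((n : ℝ) + 1)) (hyperfilter ℕ) (𝓝 0) :=
    tendsto_one_div_add_atTop_nhds_zero_nat.mono_left Nat.hyperfilter_le_atTop
  choose σ hσx hσy hσ using fun n : ℕ => h (1 / (n + 1)) Nat.one_div_pos_of_nat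
  have hlim : ∀ s, ∃ w, s ∈ Icc 0 (dist x y) →
      Tendsto (fun n => σ n s) (hyperfilter ℕ) (𝓝 w) := fun s => by
    by_cases hs : s ∈ Icc 0 (dist x y)
    · have hball : ∀ n, dist (σ n s) x ≤ dist x y + 2 := fun n => by
        have hn : 1 / ((n : ℝ) + 1) ≤ 1 := by
          rw [div_le_one (by positivity)]; linarith [n.cast_nonneg (α := ℝ)]
        have hs0 := hσ n s hs 0 hleft
        rw [sub_zero, abs_of_nonneg hs.1] at hs0
        linarith [dist_triangle (σ n s) (σ n 0) x, hσx n, hs.2]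
      obtain ⟨w, hw⟩ := exists_tendsto_ultrafilter_of_dist_le (hyperfilter ℕ) hball
      exact ⟨w, fun _ => hw⟩
    · exact ⟨x, fun hs' => absurd hs' hs⟩
  choose τ hτ using hlim
  have h0 : τ 0 = x := tendsto_nhds_unique (hτ 0 hleft)
    (tendsto_iff_dist_tendsto_zero.2 (squeeze_zero (fun _ => dist_nonneg) hσx hε))
  have h1 : τ (dist x y) = y := tendsto_nhds_unique (hτ _ hright)
    (tendsto_iff_dist_tendsto_zero.2 (squeeze_zero (fun _ => dist_nonneg) hσy hε))
  refine ⟨τ, h0, h1, dist_eq_abs_sub_of_dist_le h0 h1 fun s hs t ht => ?_⟩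
  simpa only [add_zero] using le_of_tendsto_of_tendsto' ((hτ s hs).dist (hτ t ht))
    (tendsto_const_nhds.add hε) fun n => hσ n s hs t ht

end ProperMetricSpace

section Geodesics

variable {n : ℕ} {D : Set (EuclideanSpace ℂ (Fin n))} {x y : EuclideanSpace ℂ (Fin n)}
  {γ : ℝ → EuclideanSpace ℂ (Fin n)} {a b : ℝ}

theorem tendsto_kobayashiDist_self (hD : D ∈ 𝓝 x) : Tendsto (kobayashiDist D x) (𝓝 x) (𝓝 0) :=
  (ENNReal.tendsto_toReal ENNReal.zero_ne_top).comp (tendsto_kobayashiEDist_self hD)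

theorem continuousOn_kobayashiDist (hD : IsOpen D) (hc : IsPreconnected D) (hx : x ∈ D) :
    ContinuousOn (kobayashiDist D x) D := fun w hw => by
  refine (tendsto_iff_dist_tendsto_zero.2 (squeeze_zero' (.of_forall fun _ => dist_nonneg) ?_
    (tendsto_kobayashiDist_self (hD.mem_nhds hw)))).mono_left nhdsWithin_le_nhds
  filter_upwards [hD.mem_nhds hw] with w' hw'
  have h1 := kobayashiDist_triangle hD hc hx hw hw'
  have h2 := kobayashiDist_triangle hD hc hx hw' hw
  rw [kobayashiDist_comm w'] at h2
  rw [Real.dist_eq, abs_le]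
  constructor <;> linarith

theorem isCompact_kobayashi_closedBall (hD : IsOpen D) (hc : Convex ℝ D)
    (hb : Bornology.IsBounded D) (hx : x ∈ D) (R : ℝ) :
    IsCompact {w | w ∈ D ∧ kobayashiDist D x w ≤ R} := by
  have hD' := hc.isPreconnected
  refine Metric.isCompact_of_isClosed_isBounded (isClosed_of_closure_subset fun z hz => ?_)
    (hb.subset fun w hw => hw.1)
  suffices hzD : z ∈ D from ⟨hzD, ((continuousOn_kobayashiDist hD hD' hx z hzD).mono
    fun w hw => hw.1).closure_le hz continuousWithinAt_const fun w hw => hw.2⟩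
  by_contra hzD
  obtain ⟨f, hf⟩ := RCLike.geometric_hahn_banach_open_point (𝕜 := ℂ) hc hD hzD
  have hpos : ∀ w ∈ D, 0 < (f z - f w).re := fun w hw => by
    simpa using hf w hw
  have hfar : ∀ w ∈ {w | w ∈ D ∧ kobayashiDist D x w ≤ R},
      (f z - f x).re * Real.exp (-(2 * R)) ≤ (f z - f w).re := by
    rintro w ⟨hw, hwR⟩
    have hlog := neg_le_of_abs_le (abs_log_re_sub_log_re_le hD hD'
      (contDiff_const.sub f.contDiff).contDiffOn hpos hx hw)
    rw [← Real.log_le_log_iff (mul_pos (hpos x hx) (Real.exp_pos _)) (hpos w hw),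
      Real.log_mul (hpos x hx).ne' (Real.exp_ne_zero _), Real.log_exp]
    linarith
  have hclosed : IsClosed {w | (f z - f x).re * Real.exp (-(2 * R)) ≤ (f z - f w).re} :=
    isClosed_le continuous_const (by fun_prop)
  have hfarz : (f z - f x).re * Real.exp (-(2 * R)) ≤ (f z - f z).re :=
    closure_minimal hfar hclosed hz
  rw [sub_self, Complex.zero_re] at hfarz
  exact hfarz.not_gt (mul_pos (hpos x hx) (Real.exp_pos _))

/-- The points of `D`, as a separate type that carries the Kobayashi distance instead of the
Euclidean one. -/
def KobayashiSpace (D : Set (EuclideanSpace ℂ (Fin n))) : Type := D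

/-- The Kobayashi distance of a bounded domain, as a metric. It is not an instance because it
depends on the properties of `D`. -/
@[reducible]
noncomputable def kobayashiMetricSpace (hD : IsOpen D) (hc : IsPreconnected D)
    (hb : Bornology.IsBounded D) : MetricSpace (KobayashiSpace D) where
  dist x y := kobayashiDist D x.1 y.1
  dist_self x := kobayashiDist_self x.2
  dist_comm x y := kobayashiDist_comm x.1 y.1
  dist_triangle x y z := kobayashiDist_triangle hD hc x.2 y.2 z.2
  eq_of_dist_eq_zero {x y} h := Subtype.ext <| by
    have hle := norm_sub_le_diam_mul_kobayashiDist hD hc hb y.2 x.2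
    rw [kobayashiDist_comm, h, mul_zero] at hle
    exact sub_eq_zero.1 (norm_le_zero_iff.1 hle)

theorem properSpace_kobayashiSpace (hD : IsOpen D) (hc : Convex ℝ D)
    (hb : Bornology.IsBounded D) :
    @ProperSpace (KobayashiSpace D)
      (kobayashiMetricSpace hD hc.isPreconnected hb).toPseudoMetricSpace := by
  let := kobayashiMetricSpace hD hc.isPreconnected hb
  refine ⟨fun x R => ?_⟩
  let ι : D → KobayashiSpace D := fun w => w
  have hι : Continuous ι := continuous_iff_continuousAt.2 fun w =>
    tendsto_iff_dist_tendsto_zero.2 <|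
      ((tendsto_kobayashiDist_self (hD.mem_nhds w.2)).comp
        continuous_subtype_val.continuousAt).congr fun w' => kobayashiDist_comm _ _
  have hpre := Topology.IsInducing.subtypeVal.isCompact_preimage'
    (isCompact_kobayashi_closedBall hD hc hb x.2 R) fun w hw => ⟨⟨w, hw.1⟩, rfl⟩
  refine (hpre.image hι).of_isClosed_subset Metric.isClosed_closedBall fun w hw => ?_
  exact ⟨w, ⟨w.2, (kobayashiDist_comm _ _).trans_le hw⟩, rfl⟩

theorem kobayashiEDist_add_add_le_kobayashiLength {u v : ℝ} (h : PiecewiseC1 γ a b)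
    (hm : MapsTo γ (Icc a b) D) (hu : a ≤ u) (huv : u ≤ v) (hv : v ≤ b) :
    kobayashiEDist D (γ a) (γ u) + kobayashiEDist D (γ u) (γ v) + kobayashiEDist D (γ v) (γ b) ≤
      kobayashiLength D γ (Ioo a b) := by
  obtain ⟨hav, hvb⟩ := h.split ⟨hu.trans huv, hv⟩
  obtain ⟨hau, huv'⟩ := hav.split ⟨hu, huv⟩
  rw [← kobayashiLength_add hav.le hv, ← kobayashiLength_add hu huv]
  gcongr
  · exact kobayashiEDist_le_kobayashiLength hau
      (hm.mono_left (Icc_subset_Icc_right (huv.trans hv)))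
  · exact kobayashiEDist_le_kobayashiLength huv' (hm.mono_left (Icc_subset_Icc hu hv))
  · exact kobayashiEDist_le_kobayashiLength hvb
      (hm.mono_left (Icc_subset_Icc_left (hu.trans huv)))

theorem exists_curve_kobayashiDist_add_add_le (hD : IsOpen D) (hc : IsPreconnected D)
    (hx : x ∈ D) (hy : y ∈ D) {ε : ℝ} (hε : 0 < ε) :
    ∃ γ : ℝ → EuclideanSpace ℂ (Fin n), ContinuousOn γ (Icc 0 1) ∧ MapsTo γ (Icc 0 1) D ∧
      γ 0 = x ∧ γ 1 = y ∧ ∀ u ∈ Icc (0 : ℝ) 1, ∀ v ∈ Icc (0 : ℝ) 1, u ≤ v →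
        kobayashiDist D x (γ u) + kobayashiDist D (γ u) (γ v) + kobayashiDist D (γ v) y ≤
          kobayashiDist D x y + ε := by
  have hxy := kobayashiEDist_ne_top hD hc hx hy
  obtain ⟨γ, h, hm, rfl, rfl, hl⟩ := (kobayashiEDist_lt_iff zero_lt_one).1
    (ENNReal.lt_add_right hxy (ENNReal.ofReal_pos.2 hε).ne')
  refine ⟨γ, h.continuousOn, hm, rfl, rfl, fun u hu v hv huv => ?_⟩
  have h1 := kobayashiEDist_ne_top hD hc hx (hm hu)
  have h2 := kobayashiEDist_ne_top hD hc (hm hu) (hm hv)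
  have h3 := kobayashiEDist_ne_top hD hc (hm hv) hy
  have key := ENNReal.toReal_mono (ENNReal.add_ne_top.2 ⟨hxy, ENNReal.ofReal_ne_top⟩)
    ((kobayashiEDist_add_add_le_kobayashiLength h hm hu.1 huv hv.2).trans hl.le)
  rwa [ENNReal.toReal_add (ENNReal.add_ne_top.2 ⟨h1, h2⟩) h3, ENNReal.toReal_add h1 h2,
    ENNReal.toReal_add hxy ENNReal.ofReal_ne_top, ENNReal.toReal_ofReal hε.le] at key

theorem exists_approx_kobayashiGeodesic (hD : IsOpen D) (hc : IsPreconnected D) (hx : x ∈ D)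
    (hy : y ∈ D) {ε : ℝ} (hε : 0 < ε) :
    ∃ σ : ℝ → EuclideanSpace ℂ (Fin n), (∀ s, σ s ∈ D) ∧ kobayashiDist D (σ 0) x ≤ ε ∧
      kobayashiDist D (σ (kobayashiDist D x y)) y ≤ ε ∧
      ∀ s ∈ Icc 0 (kobayashiDist D x y), ∀ t ∈ Icc 0 (kobayashiDist D x y),
        kobayashiDist D (σ s) (σ t) ≤ |s - t| + ε := by
  obtain ⟨γ, hγ, hm, h0, h1, hle⟩ := exists_curve_kobayashiDist_add_add_le hD hc hx hy hε
  have hivt := intermediate_value_Icc zero_le_one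
    ((continuousOn_kobayashiDist hD hc hx).comp hγ hm)
  have hpar : ∀ s, ∃ u ∈ Icc (0 : ℝ) 1, s ∈ Icc 0 (kobayashiDist D x y) →
      kobayashiDist D x (γ u) = s := fun s => by
    by_cases hs : s ∈ Icc 0 (kobayashiDist D x y)
    · simp only [Function.comp_apply, h0, h1, kobayashiDist_self hx] at hivt
      obtain ⟨u, hu, hus⟩ := hivt hs
      exact ⟨u, hu, fun _ => hus⟩
    · exact ⟨0, left_mem_Icc.2 zero_le_one, fun hs' => absurd hs' hs⟩
  choose u hu hus using hpar
  have hleft := hus 0 (left_mem_Icc.2 kobayashiDist_nonneg)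
  have hright := hus _ (right_mem_Icc.2 (kobayashiDist_nonneg (x := x) (y := y)))
  refine ⟨fun s => γ (u s), fun s => hm (hu s), ?_, ?_, fun s hs t ht => ?_⟩
  · rw [kobayashiDist_comm, hleft]
    exact hε.le
  · have := hle _ (hu (kobayashiDist D x y)) _ (hu _) le_rfl
    rw [hright, kobayashiDist_self (hm (hu _))] at this
    linarith
  suffices ∀ s ∈ Icc 0 (kobayashiDist D x y), ∀ t ∈ Icc 0 (kobayashiDist D x y), u s ≤ u t →
      kobayashiDist D (γ (u s)) (γ (u t)) ≤ t - s + ε by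
    rcases le_total (u s) (u t) with hst | hts
    · linarith [this s hs t ht hst, neg_abs_le (s - t)]
    · rw [kobayashiDist_comm]
      linarith [this t ht s hs hts, le_abs_self (s - t)]
  intro s hs t ht hst
  have htri := kobayashiDist_triangle hD hc hx (hm (hu t)) hy
  have := hle _ (hu s) _ (hu t) hst
  rw [hus s hs] at this
  rw [hus t ht] at htri
  linarith

theorem exists_isKobayashiGeodesic (hD : IsOpen D) (hc : Convex ℝ D)
    (hb : Bornology.IsBounded D) (hx : x ∈ D) (hy : y ∈ D) :
    ∃ σ : ℝ → EuclideanSpace ℂ (Fin n), IsKobayashiGeodesic D (kobayashiDist D x y) σ ∧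
      σ 0 = x ∧ σ (kobayashiDist D x y) = y := by
  have hD' := hc.isPreconnected
  let := kobayashiMetricSpace hD hD' hb
  have := properSpace_kobayashiSpace hD hc hb
  obtain ⟨σ, h0, h1, hσ⟩ := exists_geodesic_of_approx (X := KobayashiSpace D) (x := ⟨x, hx⟩)
    (y := ⟨y, hy⟩) fun ε hε => by
      obtain ⟨σ, hm, hσ⟩ := exists_approx_kobayashiGeodesic hD hD' hx hy hε
      exact ⟨fun s => ⟨σ s, hm s⟩, hσ⟩
  refine ⟨fun s => (σ s).1, ⟨?_, fun s _ => (σ s).2, hσ⟩, congrArg Subtype.val h0,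
    congrArg Subtype.val h1⟩
  refine (LipschitzOnWith.of_dist_le_mul (K := ⟨Metric.diam D, Metric.diam_nonneg⟩)
    fun s hs t ht => ?_).continuousOn
  rw [dist_comm, dist_eq_norm, Real.dist_eq, ← hσ s hs t ht]
  exact norm_sub_le_diam_mul_kobayashiDist hD hD' hb (σ s).2 (σ t).2

end Geodesics

section GromovProduct

variable {n : ℕ} {D : Set (EuclideanSpace ℂ (Fin n))} {o x y p q : EuclideanSpace ℂ (Fin n)}

theorem le_gromovProduct_of_re_pos (hD : IsOpen D) (hc : IsPreconnected D)
    {f : EuclideanSpace ℂ (Fin n) → ℂ} (hf : ContDiffOn ℂ 1 f D) (hre : ∀ w ∈ D, 0 < (f w).re)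
    (ho : o ∈ D) (hx : x ∈ D) (hy : y ∈ D) :
    (Real.log (f o).re - (Real.log (f x).re + Real.log (f y).re) / 2 - kobayashiDist D x y) / 2 ≤
      gromovProduct D o x y := by
  have hxo := (le_abs_self _).trans (abs_log_re_sub_log_re_le hD hc hf hre hx ho)
  have hyo := (le_abs_self _).trans (abs_log_re_sub_log_re_le hD hc hf hre hy ho)
  rw [kobayashiDist_comm y o] at hyo
  rw [gromovProduct]
  linarith

theorem gromovProduct_le_of_mem_geodesic (hD : IsOpen D) (hc : IsPreconnected D) (ho : o ∈ D)
    {L t C : ℝ} {σ : ℝ → EuclideanSpace ℂ (Fin n)} (hσ : IsKobayashiGeodesic D L σ)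
    (ht : t ∈ Icc 0 L) (hC : kobayashiDist D o (σ t) ≤ C) : gromovProduct D o (σ 0) (σ L) ≤ C := by
  have h0 : (0 : ℝ) ∈ Icc 0 L := left_mem_Icc.2 (ht.1.trans ht.2)
  have hL : L ∈ Icc 0 L := right_mem_Icc.2 (ht.1.trans ht.2)
  have h0t := hσ.2.2 0 h0 t ht
  have htL := hσ.2.2 t ht L hL
  have h0L := hσ.2.2 0 h0 L hL
  rw [zero_sub, abs_neg, abs_of_nonneg ht.1] at h0t
  rw [abs_sub_comm, abs_of_nonneg (sub_nonneg.2 ht.2)] at htL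
  rw [zero_sub, abs_neg, abs_of_nonneg (ht.1.trans ht.2)] at h0L
  have hstart := kobayashiDist_triangle hD hc (hσ.2.1 h0) (hσ.2.1 ht) ho
  have hend := kobayashiDist_triangle hD hc ho (hσ.2.1 ht) (hσ.2.1 hL)
  rw [kobayashiDist_comm (σ t) o] at hstart
  rw [gromovProduct]
  linarith

theorem HasVisibleGeodesics.exists_gromovProduct_le (h : HasVisibleGeodesics D p q)
    (hD : IsOpen D) (hc : Convex ℝ D) (hb : Bornology.IsBounded D) (ho : o ∈ D) :
    ∃ C, ∀ᶠ w in 𝓝[D ×ˢ D] (p, q), gromovProduct D o w.1 w.2 ≤ C := by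
  obtain ⟨U, hU, V, hV, -, K, hK, hKD, hgeo⟩ := h
  obtain ⟨C, hC⟩ := hK.bddAbove_image
    ((continuousOn_kobayashiDist hD hc.isPreconnected ho).mono hKD)
  refine ⟨C, ?_⟩
  filter_upwards [nhdsWithin_le_nhds (prod_mem_nhds hU hV), self_mem_nhdsWithin]
    with ⟨x, y⟩ ⟨hxU, hyV⟩ ⟨hx, hy⟩
  obtain ⟨σ, hσ, rfl, hσL⟩ := exists_isKobayashiGeodesic hD hc hb hx hy
  obtain ⟨_, ⟨t, ht, rfl⟩, htK⟩ := hgeo _ σ kobayashiDist_nonneg hσ hxU (by rwa [hσL])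
  simpa only [hσL] using gromovProduct_le_of_mem_geodesic hD hc.isPreconnected ho hσ ht
    (hC (mem_image_of_mem _ htK))

theorem limsup_coe_eq_top_of_tendsto {α β : Type*} {f : α → ℝ} {l : Filter α} {u : β → α}
    {m : Filter β} [m.NeBot] (hu : Tendsto u m l) (h : Tendsto (fun b => f (u b)) m atTop) :
    limsup (fun a => (f a : EReal)) l = ⊤ := by
  have hlim : limsup (fun b => (f (u b) : EReal)) m = ⊤ :=
    (EReal.tendsto_coe_nhds_top_iff.2 h).limsup_eq
  have hle : limsup (fun a => (f a : EReal)) (m.map u) ≤ limsup (fun a => (f a : EReal)) l :=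
    limsup_le_limsup_of_le hu
  exact top_le_iff.1 (hlim.ge.trans hle)

end GromovProduct

section RectangleDisc

theorem one_add_div_one_sub_re_pos {z : ℂ} (hz : ‖z‖ < 1) : 0 < ((1 + z) / (1 - z)).re := by
  have hne : 1 - z ≠ 0 := fun h => by simp [← sub_eq_zero.1 h] at hz
  have hsq : z.re * z.re + z.im * z.im < 1 := by
    rw [← Complex.normSq_apply, ← Complex.sq_norm]
    exact pow_lt_one₀ (norm_nonneg z) hz two_ne_zero
  rw [Complex.div_re, ← add_div]
  refine div_pos ?_ (Complex.normSq_pos.2 hne)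
  simp only [Complex.add_re, Complex.sub_re, Complex.one_re, Complex.add_im, Complex.sub_im,
    Complex.one_im]
  linarith

theorem norm_one_add_div_one_sub_le {z : ℂ} {r : ℝ} (hz : ‖z‖ ≤ r) (hr : r < 1) :
    ‖(1 + z) / (1 - z)‖ ≤ (1 + r) / (1 - r) := by
  have hnum : ‖1 + z‖ ≤ 1 + r := (norm_add_le _ _).trans (by rw [norm_one]; gcongr)
  have hden : 1 - r ≤ ‖1 - z‖ := le_trans (by rw [norm_one]; gcongr) (norm_sub_norm_le 1 z)
  rw [norm_div]
  exact div_le_div₀ ((norm_nonneg _).trans hnum) hnum (sub_pos.2 hr) hden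

theorem abs_log_norm_one_add_div_one_sub_le {z : ℂ} {r : ℝ} (hz : ‖z‖ ≤ r) (hr : r < 1) :
    |Real.log ‖(1 + z) / (1 - z)‖| ≤ 2 * Real.artanh r := by
  suffices ∀ z : ℂ, ‖z‖ ≤ r → Real.log ‖(1 + z) / (1 - z)‖ ≤ 2 * Real.artanh r by
    refine abs_le'.2 ⟨this z hz, ?_⟩
    simpa only [← Real.log_inv, ← norm_inv, inv_div, ← sub_eq_add_neg, sub_neg_eq_add] using
      this (-z) (by rwa [norm_neg])
  intro z hz
  have hr0 : 0 ≤ r := (norm_nonneg z).trans hz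
  rw [Real.artanh_eq_half_log ⟨by linarith, hr.le⟩, one_div, mul_inv_cancel_left₀ two_ne_zero]
  refine Real.log_le_log (norm_pos_iff.2 fun h => ?_) (norm_one_add_div_one_sub_le hz hr)
  exact (one_add_div_one_sub_re_pos (hz.trans_lt hr)).ne' (by rw [h, Complex.zero_re])

theorem div_one_add_le_tanh {x : ℝ} (hx : 0 ≤ x) : x / (1 + x) ≤ Real.tanh x := by
  rw [Real.tanh_eq, Real.exp_neg, div_le_div_iff₀ (by positivity) (by positivity)]
  have hexp : 1 + x ≤ Real.exp x := by linarith [Real.add_one_le_exp x]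
  have hsq : 1 + 2 * x ≤ Real.exp x * Real.exp x := by nlinarith
  have hinv : Real.exp x * (Real.exp x)⁻¹ = 1 := mul_inv_cancel₀ (Real.exp_ne_zero x)
  have := mul_le_mul_of_nonneg_right hsq (inv_nonneg.2 (Real.exp_nonneg x))
  rw [mul_assoc, hinv] at this
  linarith

theorem exists_disc_in_strip {u : ℝ} (hu : 0 ≤ u) :
    ∃ g : ℂ → ℂ, DifferentiableOn ℂ g (Metric.ball 0 1) ∧
      (∀ ζ ∈ Metric.ball (0 : ℂ) 1, |(g ζ).im| < Real.pi / 2 ∧ |(g ζ).re| ≤ 2 * u) ∧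
      g 0 = 0 ∧ HasDerivAt g (2 * Real.tanh u : ℝ) 0 := by
  set r := Real.tanh u
  have hr : 0 ≤ r := (by positivity : 0 ≤ u / (1 + u)).trans (div_one_add_le_tanh hu)
  have hnorm : ∀ ζ ∈ Metric.ball (0 : ℂ) 1, ‖(r : ℂ) * ζ‖ ≤ r := fun ζ hζ => by
    rw [norm_mul, Complex.norm_real, Real.norm_of_nonneg hr]
    exact mul_le_of_le_one_right hr (mem_ball_zero_iff.1 hζ).le
  have hre : ∀ ζ ∈ Metric.ball (0 : ℂ) 1, 0 < ((1 + r * ζ) / (1 - r * ζ)).re := fun ζ hζ =>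
    one_add_div_one_sub_re_pos ((hnorm ζ hζ).trans_lt (Real.tanh_lt_one u))
  have hne : ∀ ζ ∈ Metric.ball (0 : ℂ) 1, 1 - r * ζ ≠ 0 := fun ζ hζ h => by
    simpa only [h, div_zero, Complex.zero_re, lt_irrefl] using hre ζ hζ
  have h0 : (0 : ℂ) ∈ Metric.ball (0 : ℂ) 1 := Metric.mem_ball_self one_pos
  refine ⟨fun ζ => Complex.log ((1 + r * ζ) / (1 - r * ζ)),
    .clog (.div (by fun_prop) (by fun_prop) hne) fun ζ hζ => .inl (hre ζ hζ),
    fun ζ hζ => ⟨?_, ?_⟩, by simp, ?_⟩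
  · rw [Complex.log_im]
    exact Complex.abs_arg_lt_pi_div_two_iff.2 (.inl (hre ζ hζ))
  · rw [Complex.log_re, ← Real.artanh_tanh u]
    exact abs_log_norm_one_add_div_one_sub_le (hnorm ζ hζ) (Real.tanh_lt_one u)
  · have hmul : HasDerivAt (fun ζ : ℂ => (r : ℂ) * ζ) r 0 := by
      simpa using (hasDerivAt_id (0 : ℂ)).const_mul (r : ℂ)
    refine (((hmul.const_add 1).div (hmul.const_sub 1) (hne 0 h0)).clog
      (.inl (hre 0 h0))).congr_deriv ?_
    simp only [Pi.div_apply, mul_zero, add_zero, sub_zero, div_one, one_pow, Complex.ofReal_mul,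
      Complex.ofReal_ofNat]
    ring

/- For `c = 2 a / π`, multiplication by `i c` turns the strip `|Im| < π / 2` into `|Re| < a`, and
`u = b / (2 c)` is as large as `|Im| ≤ b` permits. -/
theorem exists_disc_in_rectangle {a b : ℝ} (ha : 0 < a) (hb : 0 < b) :
    ∃ h : ℂ → ℂ, DifferentiableOn ℂ h (Metric.ball 0 1) ∧
      (∀ ζ ∈ Metric.ball (0 : ℂ) 1, |(h ζ).re| < a ∧ |(h ζ).im| ≤ b) ∧ h 0 = 0 ∧
      deriv h 0 ≠ 0 ∧ ‖deriv h 0‖⁻¹ ≤ Real.pi / (4 * a) + 1 / b := by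
  obtain ⟨c, hc, hca⟩ : ∃ c : ℝ, 0 < c ∧ c * Real.pi = 2 * a :=
    ⟨2 * a / Real.pi, by positivity, div_mul_cancel₀ _ Real.pi_ne_zero⟩
  set u := b / (2 * c)
  have hu : 0 < u := by positivity
  have htanh : u / (1 + u) ≤ Real.tanh u := div_one_add_le_tanh hu.le
  have htanh0 : 0 < Real.tanh u := (by positivity : 0 < u / (1 + u)).trans_le htanh
  obtain ⟨g, hd, hm, h0, hder⟩ := exists_disc_in_strip hu.le
  have hder' := (hder.const_mul (Complex.I * c)).deriv
  have hnorm : ‖Complex.I * c * (2 * Real.tanh u : ℝ)‖ = c * (2 * Real.tanh u) := by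
    rw [norm_mul, norm_mul, Complex.norm_I, one_mul, Complex.norm_of_nonneg hc.le,
      Complex.norm_of_nonneg (by positivity)]
  refine ⟨fun ζ => Complex.I * c * g ζ, hd.const_mul _, fun ζ hζ => ⟨?_, ?_⟩,
    mul_eq_zero_of_right _ h0, ?_, ?_⟩
  · dsimp only
    rw [mul_assoc, Complex.I_mul_re, Complex.im_ofReal_mul, abs_neg, abs_mul, abs_of_pos hc]
    nlinarith [(hm ζ hζ).1]
  · dsimp only
    rw [mul_assoc, Complex.I_mul_im, Complex.re_ofReal_mul, abs_mul, abs_of_pos hc]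
    calc c * |(g ζ).re| ≤ c * (2 * u) := by gcongr; exact (hm ζ hζ).2
      _ = b := by simp only [u]; field_simp
  · rw [hder', ← norm_pos_iff, hnorm]
    positivity
  · rw [hder', hnorm]
    calc (c * (2 * Real.tanh u))⁻¹ ≤ (c * (2 * (u / (1 + u))))⁻¹ := by gcongr
      _ = 1 / (2 * c) + 1 / b := by simp only [u]; field_simp; ring
      _ = Real.pi / (4 * a) + 1 / b := by
        rw [show 4 * a = 2 * c * Real.pi by linarith, div_mul_cancel_right₀ Real.pi_ne_zero,
          one_div]

variable {n : ℕ} {D : Set (EuclideanSpace ℂ (Fin n))} {z v : EuclideanSpace ℂ (Fin n)} {a b : ℝ}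

theorem kobayashiRoyden_le_of_rectangle (ha : 0 < a) (hb : 0 < b)
    (hD : ∀ ζ : ℂ, |ζ.re| < a → |ζ.im| ≤ b → z + ζ • v ∈ D) :
    kobayashiRoyden D z v ≤ Real.pi / (4 * a) + 1 / b := by
  obtain ⟨h, hd, hm, h0, hne, hle⟩ := exists_disc_in_rectangle ha hb
  have hder : HasDerivAt (fun ζ => z + h ζ • v) (deriv h 0 • v) 0 :=
    ((hd.differentiableAt (Metric.ball_mem_nhds 0 one_pos)).hasDerivAt.smul_const v).const_add z
  refine (kobayashiRoyden_le (α := (deriv h 0)⁻¹) ((hd.smul_const v).const_add z)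
    (fun ζ hζ => hD _ (hm ζ hζ).1 (hm ζ hζ).2) ?_ ?_).trans ((norm_inv _).trans_le hle)
  · rw [h0, zero_smul, add_zero]
  · rw [hder.deriv, inv_smul_smul₀ hne]

theorem kobayashiDist_le_of_rectangle {R : ℝ} (ha : 0 < a) (hb : 0 < b) (hR : 0 ≤ R)
    (hD : ∀ ζ : ℂ, |ζ.re| < a → |ζ.im| ≤ R + b → z + ζ • v ∈ D) :
    kobayashiDist D (z + (R * Complex.I) • v) (z - (R * Complex.I) • v) ≤
      2 * R * (Real.pi / (4 * a) + 1 / b) := by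
  refine ENNReal.toReal_le_of_le_ofReal (by positivity)
    (kobayashiEDist_le_of_segment fun t ht => ?_)
  have hline : AffineMap.lineMap (z + (R * Complex.I) • v) (z - (R * Complex.I) • v) t =
      z + ((R * (1 - 2 * t) : ℝ) * Complex.I) • v := by
    rw [AffineMap.lineMap_apply_module', ← Complex.coe_smul]
    push_cast
    module
  have hdir : z - (R * Complex.I) • v - (z + (R * Complex.I) • v) =
      (-(2 * R : ℝ) * Complex.I) • v := by
    push_cast
    module
  have ht' : |R * (1 - 2 * t)| ≤ R := by
    rw [abs_mul, abs_of_nonneg hR]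
    exact mul_le_of_le_one_right hR (abs_le.2 ⟨by linarith [ht.2], by linarith [ht.1]⟩)
  have hrect : ∀ ζ : ℂ, |ζ.re| < a → |ζ.im| ≤ b →
      z + ((R * (1 - 2 * t) : ℝ) * Complex.I) • v + ζ • v ∈ D := fun ζ hre him => by
    rw [add_assoc, ← add_smul]
    refine hD _ (by simpa using hre) ?_
    rw [Complex.add_im, Complex.im_ofReal_mul, Complex.I_im, mul_one]
    exact (abs_add_le _ _).trans (add_le_add ht' him)
  rw [hline, hdir, kobayashiRoyden_smul]
  refine ⟨by simpa using hrect 0 (by simpa using ha) (by simpa using hb.le), ?_⟩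
  calc _ = 2 * R * kobayashiRoyden D (z + ((R * (1 - 2 * t) : ℝ) * Complex.I) • v) v := by
        simp [abs_of_nonneg hR]
    _ ≤ 2 * R * (Real.pi / (4 * a) + 1 / b) := by
        gcongr
        exact kobayashiRoyden_le_of_rectangle ha hb hrect

end RectangleDisc

section Asymptotics

theorem tendsto_neg_log_sub_atTop {α : Type*} {l : Filter α} {f g : α → ℝ}
    (hf : ∀ᶠ x in l, 0 < f x) (h : f =o[l] fun x => Real.exp (-g x)) :
    Tendsto (fun x => -Real.log (f x) - g x) l atTop := by
  have hdiv : Tendsto (fun x => f x / Real.exp (-g x)) l (𝓝[>] 0) :=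
    tendsto_nhdsWithin_iff.2
      ⟨h.tendsto_div_nhds_zero, hf.mono fun x hx => div_pos hx (Real.exp_pos _)⟩
  refine (tendsto_neg_atBot_atTop.comp (Real.tendsto_log_nhdsGT_zero.comp hdiv)).congr' ?_
  filter_upwards [hf] with x hx
  simp only [Function.comp_apply]
  rw [Real.log_div hx.ne' (Real.exp_ne_zero _), Real.log_exp]
  ring

theorem tendsto_exp_neg_div_nhdsGT_zero {c : ℝ} (hc : 0 < c) :
    Tendsto (fun x => Real.exp (-(c / x))) (𝓝[>] 0) (𝓝 0) :=
  Real.tendsto_exp_neg_atTop_nhds_zero.comp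
    (tendsto_inv_nhdsGT_zero.const_mul_atTop hc)

variable {n : ℕ} {D : Set (EuclideanSpace ℂ (Fin n))} {o : EuclideanSpace ℂ (Fin n)}

theorem tendsto_gromovProduct_atTop (hD : IsOpen D) (hc : IsPreconnected D)
    {f : EuclideanSpace ℂ (Fin n) → ℂ} (hf : ContDiffOn ℂ 1 f D) (hre : ∀ w ∈ D, 0 < (f w).re)
    (ho : o ∈ D) {β : Type*} {l : Filter β} {x y : β → EuclideanSpace ℂ (Fin n)}
    (hxy : ∀ᶠ b in l, x b ∈ D ∧ y b ∈ D)
    (h : Tendsto (fun b => -(Real.log (f (x b)).re + Real.log (f (y b)).re) / 2 -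
      kobayashiDist D (x b) (y b)) l atTop) :
    Tendsto (fun b => gromovProduct D o (x b) (y b)) l atTop := by
  refine tendsto_atTop_mono' l ?_
    ((tendsto_atTop_add_const_left l (Real.log (f o).re) h).atTop_div_const two_pos)
  filter_upwards [hxy] with b hb
  refine le_trans (le_of_eq ?_) (le_gromovProduct_of_re_pos hD hc hf hre ho hb.1 hb.2)
  ring

end Asymptotics

section Channel

variable {ψ : ℝ → ℝ} {Ω : Set (EuclideanSpace ℂ (Fin 2))}

theorem kobayashiDist_le_of_channel {x : ℝ} {w : ℂ} (hx : 0 < x)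
    (h : ∀ z : ℂ, |z.re| < x → |z.im| ≤ 2 → !₂[z, w] ∈ Ω) :
    kobayashiDist Ω !₂[Complex.I, w] !₂[-Complex.I, w] ≤ Real.pi / (2 * x) + 2 := by
  have hline : ∀ z : ℂ, !₂[0, w] + z • !₂[1, 0] = !₂[z, w] := fun z => by
    ext i
    fin_cases i <;> simp
  have key := kobayashiDist_le_of_rectangle (D := Ω) (z := !₂[0, w]) (v := !₂[1, 0]) hx one_pos
    zero_le_one fun ζ hre him => hline ζ ▸ h ζ hre (him.trans_eq one_add_one_eq_two)
  rw [sub_eq_add_neg, ← neg_smul, hline, hline, Complex.ofReal_one, one_mul] at key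
  exact key.trans_eq (by field_simp; ring)

theorem eventually_mem_channel
    (hΩ : ∀ᶠ x in 𝓝[>] 0, ∀ z : ℂ, |z.re| < x → |z.im| ≤ 2 → !₂[z, (ψ x : ℂ)] ∈ Ω) :
    ∀ᶠ x in 𝓝[>] 0, !₂[Complex.I, (ψ x : ℂ)] ∈ Ω ∧ !₂[-Complex.I, (ψ x : ℂ)] ∈ Ω := by
  filter_upwards [hΩ, self_mem_nhdsWithin] with x hx hx0
  exact ⟨hx _ (by simpa using hx0) (by simp), hx _ (by simpa using hx0) (by simp)⟩

theorem tendsto_channel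
    (hΩ : ∀ᶠ x in 𝓝[>] 0, ∀ z : ℂ, |z.re| < x → |z.im| ≤ 2 → !₂[z, (ψ x : ℂ)] ∈ Ω)
    (hψ : Tendsto ψ (𝓝[>] 0) (𝓝 0)) :
    Tendsto (fun x => (!₂[Complex.I, (ψ x : ℂ)], !₂[-Complex.I, (ψ x : ℂ)])) (𝓝[>] 0)
      (𝓝[Ω ×ˢ Ω] (!₂[Complex.I, 0], !₂[-Complex.I, 0])) := by
  have hlim : ∀ z : ℂ, Tendsto (fun x => !₂[z, (ψ x : ℂ)]) (𝓝[>] 0) (𝓝 !₂[z, 0]) := fun z => by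
    have hcont : Continuous fun w : ℂ => !₂[z, w] := by fun_prop
    exact (hcont.tendsto 0).comp ((Complex.continuous_ofReal.tendsto' 0 0 rfl).comp hψ)
  exact tendsto_nhdsWithin_iff.2
    ⟨(hlim Complex.I).prodMk_nhds (hlim (-Complex.I)), eventually_mem_channel hΩ⟩

theorem tendsto_gromovProduct_channel (hopen : IsOpen Ω) (hconn : IsPreconnected Ω)
    (hre : ∀ w ∈ Ω, 0 < (w 1).re)
    (hΩ : ∀ᶠ x in 𝓝[>] 0, ∀ z : ℂ, |z.re| < x → |z.im| ≤ 2 → !₂[z, (ψ x : ℂ)] ∈ Ω)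
    (hψ : ψ =o[𝓝[>] 0] fun x => Real.exp (-(Real.pi / (2 * x))))
    {o : EuclideanSpace ℂ (Fin 2)} (ho : o ∈ Ω) :
    Tendsto (fun x => gromovProduct Ω o !₂[Complex.I, (ψ x : ℂ)] !₂[-Complex.I, (ψ x : ℂ)])
      (𝓝[>] 0) atTop := by
  have hmem := eventually_mem_channel hΩ
  refine tendsto_gromovProduct_atTop hopen hconn (f := fun w => w 1)
    (EuclideanSpace.proj (𝕜 := ℂ) (1 : Fin 2)).contDiff.contDiffOn hre ho hmem ?_
  have hlog := tendsto_neg_log_sub_atTop (hmem.mono fun x hx => by simpa using hre _ hx.1) hψ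
  refine tendsto_atTop_mono' _ ?_ (tendsto_atTop_add_const_right _ (-2) hlog)
  filter_upwards [hΩ, self_mem_nhdsWithin] with x hx hx0
  have hdist := kobayashiDist_le_of_channel hx0 hx
  simp only [Matrix.cons_val_one, Matrix.cons_val_fin_one, Complex.ofReal_re]
  linarith

theorem mem_frontier_of_re_pos {n : ℕ} {D : Set (EuclideanSpace ℂ (Fin n))}
    {p : EuclideanSpace ℂ (Fin n)} {i : Fin n} (hre : ∀ w ∈ D, 0 < (w i).re) (hp : p ∈ closure D)
    (hpi : (p i).re = 0) : p ∈ frontier D :=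
  ⟨hp, fun h => (hre p (interior_subset h)).ne' hpi⟩

end Channel

section ModelDomain

variable {ψ χ₁ χ₂ : ℝ → ℝ} {Ω : Set (EuclideanSpace ℂ (Fin 2))}

theorem IsProfile.lt_of_abs_lt {f : ℝ → ℝ} (hf : IsProfile f) {x y : ℝ} (h : |y| < x) :
    f y < f x := by
  have hfy : f |y| = f y := by
    rcases abs_choice y with hy | hy <;> rw [hy]
    exact hf.even y
  exact hfy ▸ hf.strictMonoOn (abs_nonneg y) ((abs_nonneg y).trans h.le) h

theorem IsModelDomain.mem_of_abs_re_lt (hΩ : IsModelDomain ψ χ₁ χ₂ Ω) (hψ : IsProfile ψ)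
    (hχ₁ : IsProfile χ₁) (hχ₂ : IsProfile χ₂) {x : ℝ} (hx : x ≤ 1) (hψx : ψ x ≤ 1) {z : ℂ}
    (hre : |z.re| < x) (him : |z.im| ≤ 2) : !₂[z, (ψ x : ℂ)] ∈ Ω := by
  refine (hΩ.inter_ball.symm.subset ⟨?_, ?_⟩).1
  · have hre_sq : z.re ^ 2 ≤ 1 := (sq_le_one_iff_abs_le_one _).2 (hre.le.trans hx)
    have him_sq : z.im ^ 2 ≤ 2 ^ 2 := sq_le_sq.2 (by rwa [abs_two])
    have hψ_sq : ψ x ^ 2 ≤ 1 := pow_le_one₀ (hψ.nonneg x) hψx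
    have hnorm : ‖!₂[z, (ψ x : ℂ)]‖ ^ 2 = z.re ^ 2 + z.im ^ 2 + ψ x ^ 2 := by
      simp [EuclideanSpace.norm_sq_eq, Complex.sq_norm, Complex.normSq_apply, ← sq]
    exact lt_of_pow_lt_pow_left₀ 2 (by norm_num) (by linarith)
  · have him_max : max (|z.im| - 2) 0 = 0 := max_eq_right (by linarith)
    simpa [him_max, hχ₁.map_zero, hχ₂.map_zero] using hψ.lt_of_abs_lt hre

theorem IsModelDomain.eventually_channel_subset (hΩ : IsModelDomain ψ χ₁ χ₂ Ω)
    (hψ : IsProfile ψ) (hχ₁ : IsProfile χ₁) (hχ₂ : IsProfile χ₂) :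
    ∀ᶠ x in 𝓝[>] 0, ∀ z : ℂ, |z.re| < x → |z.im| ≤ 2 → !₂[z, (ψ x : ℂ)] ∈ Ω := by
  have hψ0 : Tendsto ψ (𝓝 0) (𝓝 0) := hψ.contDiff.continuous.tendsto' 0 0 hψ.map_zero
  filter_upwards [nhdsWithin_le_nhds (eventually_le_nhds one_pos),
    nhdsWithin_le_nhds (hψ0.eventually_le_const one_pos)] with x hx hψx z hre him
  exact hΩ.mem_of_abs_re_lt hψ hχ₁ hχ₂ hx hψx hre him

theorem IsModelDomain.zero_mem_closure (hΩ : IsModelDomain ψ χ₁ χ₂ Ω) (hψ : IsProfile ψ)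
    (hχ₁ : IsProfile χ₁) (hχ₂ : IsProfile χ₂) : 0 ∈ closure Ω := by
  have hcont : Continuous fun x => (!₂[0, (ψ x : ℂ)] : EuclideanSpace ℂ (Fin 2)) := by
    have := hψ.contDiff.continuous
    fun_prop
  have hzero : (!₂[0, (ψ 0 : ℂ)] : EuclideanSpace ℂ (Fin 2)) = 0 := by
    ext i
    fin_cases i <;> simp [hψ.map_zero]
  have hlim := (hcont.tendsto' 0 0 hzero).mono_left (nhdsWithin_le_nhds (s := Ioi 0))
  refine mem_closure_of_tendsto hlim ?_
  filter_upwards [hΩ.eventually_channel_subset hψ hχ₁ hχ₂, self_mem_nhdsWithin] with x hx hx0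
  exact hx 0 (by simpa using hx0) (by simp)

theorem IsModelDomain.re_pos (hΩ : IsModelDomain ψ χ₁ χ₂ Ω) (hψ : IsProfile ψ)
    (hχ₁ : IsProfile χ₁) (hχ₂ : IsProfile χ₂) {w : EuclideanSpace ℂ (Fin 2)} (hw : w ∈ Ω) :
    0 < (w 1).re := by
  -- The defining inequality is only available in `B(0,3)`, and `w / 2` lies there.
  have hhalf : (1 / 2 : ℝ) • w ∈ Ω := by
    have hmid := hΩ.convex.combo_closure_interior_mem_interior (hΩ.zero_mem_closure hψ hχ₁ hχ₂)
      (hΩ.isOpen.interior_eq.symm ▸ hw) one_half_pos.le one_half_pos (add_halves (1 : ℝ))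
    simpa only [smul_zero, zero_add] using interior_subset hmid
  have hnorm : ‖(1 / 2 : ℝ) • w‖ < 3 := by
    have hw5 : ‖w‖ < 5 := mem_ball_zero_iff.1 (hΩ.subset_ball hw)
    rw [norm_smul, Real.norm_of_nonneg one_half_pos.le]
    linarith
  have hgt := (hΩ.inter_ball.subset ⟨hhalf, hnorm⟩).2
  have hpos := (add_nonneg (add_nonneg (hψ.nonneg _) (hχ₁.nonneg _)) (hχ₂.nonneg _)).trans_lt hgt
  rw [PiLp.smul_apply, Complex.smul_re, smul_eq_mul] at hpos
  linarith

end ModelDomain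

theorem mainTheorem9_general {ψ : ℝ → ℝ} {Ω : Set (EuclideanSpace ℂ (Fin 2))}
    (hopen : IsOpen Ω) (hconv : Convex ℝ Ω)
    (hb : Bornology.IsBounded Ω) (hre : ∀ w ∈ Ω, 0 < (w 1).re)
    (hΩ : ∀ᶠ x in 𝓝[>] 0, ∀ z : ℂ, |z.re| < x → |z.im| ≤ 2 → !₂[z, (ψ x : ℂ)] ∈ Ω)
    (hψ : ψ =o[𝓝[>] (0 : ℝ)] fun x : ℝ => Real.exp (-(Real.pi / (2 * x)))) :
    (∀ o ∈ Ω,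
      limsup
        (fun w : EuclideanSpace ℂ (Fin 2) × EuclideanSpace ℂ (Fin 2) =>
          ((gromovProduct Ω o w.1 w.2 : ℝ) : EReal))
        (𝓝[Ω ×ˢ Ω] ((!₂[Complex.I, 0] : EuclideanSpace ℂ (Fin 2)),
          (!₂[-Complex.I, 0] : EuclideanSpace ℂ (Fin 2)))) = ⊤) ∧
    ¬ HasVisibilityProperty Ω := by
  have hψ0 : Tendsto ψ (𝓝[>] 0) (𝓝 0) := hψ.isBigO.trans_tendsto
    (by simpa only [div_div] using tendsto_exp_neg_div_nhdsGT_zero (half_pos Real.pi_pos))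
  have hlim := tendsto_channel hΩ hψ0
  have hgromov := fun o =>
    tendsto_gromovProduct_channel hopen hconv.isPreconnected hre hΩ hψ (o := o)
  refine ⟨fun o ho => limsup_coe_eq_top_of_tendsto hlim (hgromov o ho), fun hvis => ?_⟩
  obtain ⟨x, ho, -⟩ := (eventually_mem_channel hΩ).exists
  have hclosure : ((!₂[Complex.I, 0] : EuclideanSpace ℂ (Fin 2)),
      (!₂[-Complex.I, 0] : EuclideanSpace ℂ (Fin 2))) ∈ closure (Ω ×ˢ Ω) :=
    mem_closure_iff_nhdsWithin_neBot.2 hlim.neBot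
  rw [closure_prod_eq] at hclosure
  have hne : (!₂[Complex.I, 0] : EuclideanSpace ℂ (Fin 2)) ≠ !₂[-Complex.I, 0] := fun h => by
    have him := congrArg (fun w : EuclideanSpace ℂ (Fin 2) => (w 0).im) h
    norm_num at him
  have hvisible := hvis _ (mem_frontier_of_re_pos hre hclosure.1 (by simp)) _
    (mem_frontier_of_re_pos hre hclosure.2 (by simp)) hne
  obtain ⟨C, hC⟩ := hvisible.exists_gromovProduct_le hopen hconv hb ho
  obtain ⟨x, hx, hx'⟩ := ((hlim.eventually hC).and
    ((hgromov _ ho).eventually_gt_atTop C)).exists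
  exact hx.not_gt hx'

theorem mainTheorem9 (ψ χ₁ χ₂ : ℝ → ℝ) (hψ : IsProfile ψ) (hχ₁ : IsProfile χ₁)
    (hχ₂ : IsProfile χ₂) (Ω : Set (EuclideanSpace ℂ (Fin 2))) (hΩ : IsModelDomain ψ χ₁ χ₂ Ω)
    (hψo : ψ =o[𝓝[>] (0 : ℝ)] fun x : ℝ => Real.exp (-(Real.pi / (2 * x)))) :
    (∀ o ∈ Ω,
      limsup
        (fun w : EuclideanSpace ℂ (Fin 2) × EuclideanSpace ℂ (Fin 2) =>
          ((gromovProduct Ω o w.1 w.2 : ℝ) : EReal))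
        (𝓝[Ω ×ˢ Ω] ((!₂[Complex.I, 0] : EuclideanSpace ℂ (Fin 2)),
          (!₂[-Complex.I, 0] : EuclideanSpace ℂ (Fin 2)))) = ⊤) ∧
    ¬ HasVisibilityProperty Ω :=
  mainTheorem9_general hΩ.isOpen hΩ.convex (Metric.isBounded_ball.subset hΩ.subset_ball)
    (fun _ hw => hΩ.re_pos hψ hχ₁ hχ₂ hw) (hΩ.eventually_channel_subset hψ hχ₁ hχ₂) hψo
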